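/- Let $1\le L\le N$ be integers, let $\mathcal P_s\subseteq\{0,\dots,N-1\}$ be a non-empty set of $s$ subcarriers, and let $D>0$, $\Delta>0$, $\theta_1,\theta_2\in\mathbb R$, $\rho_{\rm B},\rho_{\rm A}>0$ and phases $\phi_0,\phi_1,\varphi_0,\varphi_1\in\mathbb R$ be given. Put ${\bf x}_{1}=\sqrt{\rho_{\rm B}}\,[e^{j\phi_0},e^{j\phi_1}]^{\rm T}$ (Bob's pilots at two symbol times), ${\bf x}_{2}=\sqrt{\rho_{\rm A}}\,[e^{j\varphi_0},e^{j\varphi_1}]^{\rm T}$ (Ava's pilots) and ${\bf X}=[{\bf x}_1\ {\bf x}_2]$, and assume that ${\bf X}$ is invertible or $\rho_{\rm B}=\rho_{\rm A}$. Let ${\bf F}$ be the unitary $N\times N$ DFT matrix, ${\bf F}_{s}$ its rows indexed by $\mathcal P_s$, ${\bf F}_{{\rm L},s}$ the rows indexed by $\mathcal P_s$ of $\sqrt N\,{\bf F}(:,1{:}L)$, and ${\bf R}_{\rm F}={\bf F}_{{\rm L},s}^{\rm T}{\bf F}_{{\rm L},s}^{*}$. For a number $N_{\rm T}$ of antennas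 and a noise power $\sigma^2>0$, let ${\bf h}_{\rm B}^i,{\bf h}_{\rm A}^i\in\mathbb C^{L}$ ($1\le i\le N_{\rm T}$) be the random channel impulse responses of Bob and Ava: the $L$ taps are independent and each tap is, across the antennas, a circularly symmetric complex Gaussian vector with covariance matrix ${\bf R}_1$ (Bob) or ${\bf R}_2$ (Ava), where $[{\bf R}_k]_{m,n}=\frac1{2\Delta L}\int_{\theta_k-\Delta}^{\theta_k+\Delta}e^{-j2\pi D(m-n)\sin\theta}\,d\theta$. Let the time-domain noise vectors ${\bf v}^i[k]\sim\mathcal{CN}(0,\sigma^2{\bf I}_N)$ be independent over the antennas $i$ and the two symbol times $k$, and let Bob's channels, Ava's channels and the noise be independent. Let ${\bf h}_{\rm B,L}$ and ${\bf h}_{\rm A,L}$ be the $1\times N_{\rm T}s$ rows obtained by concatenating $({\bf F}_{{\rm L},s}{\bf h}^i_{\rm B})^{\rm T}$, respectively $({\bf F}_{{\rm L},s}{\bf h}^i_{\rm A})^{\rm T}$, over $i$; let ${\bf N}$ be the $2\times N_{\rm T}s$ matrix whose rows concatenate $({\bf F}_s{\bf v}^i[k])^{\rm T}$ over $i$; and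 let ${\bf Y}={\bf x}_1{\bf h}_{\rm B,L}+{\bf x}_2{\bf h}_{\rm A,L}+{\bf N}$. With ${\bf C}=\frac1{N_{\rm T}s}{\bf Y}{\bf Y}^{\rm H}$, $T_{\rm B}=\frac{{\rm Tr}({\bf R}_1){\rm Tr}({\bf R}_{\rm F})}{N_{\rm T}s}$ and $T_{\rm A}=\frac{{\rm Tr}({\bf R}_2){\rm Tr}({\bf R}_{\rm F})}{N_{\rm T}s}$, the asymptotically optimal LMMSE estimates are $\widehat{\bf h}_{\rm B,L}=T_{\rm B}{\bf x}_1^{\rm H}{\bf C}^{-1}{\bf Y}$ and $\widehat{\bf h}_{\rm A,L}=T_{\rm A}{\bf x}_2^{\rm H}{\bf C}^{-1}{\bf Y}$, and their normalised mean square errors are $\varepsilon_{\rm B}^2=\frac{\mathbb E\|\widehat{\bf h}_{\rm B,L}-{\bf h}_{\rm B,L}\|^2}{N_{\rm T}s}$ and $\varepsilon_{\rm A}^2=\frac{\mathbb E\|\widehat{\bf h}_{\rm A,L}-{\bf h}_{\rm A,L}\|^2}{N_{\rm T}s}$. Then, for each $\sigma^2>0$, both errors are finite for all large $N_{\rm T}$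 and converge as $N_{\rm T}\to\infty$; and as $\sigma^2\to0^+$ these two large-array limits converge to a common value: $$\lim_{\sigma^2\to0^+}\lim_{N_{\rm T}\to\infty}\varepsilon_{\rm B}^2=\lim_{\sigma^2\to0^+}\lim_{N_{\rm T}\to\infty}\varepsilon_{\rm A}^2 .$$ -/

import Mathlib

open MeasureTheory ProbabilityTheory Filter Topology
open scoped NNReal Matrix Kronecker

namespace PilotTraining

noncomputable section

/-- The circularly symmetric complex Gaussian law `CN(0, v)` on `ℂ`: the real and imaginary parts
are independent centred real Gaussians of variance `v / 2` each. -/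
def complexGaussian (v : ℝ≥0) : Measure ℂ :=
  ((gaussianReal 0 (v / 2)).prod (gaussianReal 0 (v / 2))).map
    (fun p : ℝ × ℝ => (p.1 : ℂ) + (p.2 : ℂ) * Complex.I)

/-- The finite random vector `h` has law `CN(0, Γ)`: each linear combination `∑ aᵢ hᵢ` has the
circularly symmetric Gaussian law whose variance is `∑ aᵢ Γᵢⱼ conj aⱼ`
(so that `E[hᵢ conj hⱼ] = Γᵢⱼ`). -/
def IsCircularGaussian {Ω ι : Type*} [MeasurableSpace Ω] [Fintype ι] (μ : Measure Ω)
    (h : ι → Ω → ℂ) (Γ : Matrix ι ι ℂ) : Prop :=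
  ∀ a : ι → ℂ, ∃ v : ℝ≥0,
    (((v : ℝ) : ℂ) = ∑ i, ∑ j, a i * Γ i j * star (a j)) ∧
      HasLaw (fun ω => ∑ i, a i * h i ω) (complexGaussian v) μ

/-- The deterministic parameters of the two-symbol uplink training with `N` FFT points and `L`
channel taps. Users are indexed by `Fin 2`: user `0` is Bob, user `1` is Ava. The two OFDM symbol
times are also indexed by `Fin 2`. -/
structure Setup (N L : ℕ) where
  /-- the set of overlapping subcarriers -/
  P : Finset (Fin N)
  /-- the antenna spacing, in wavelengths -/
  D : ℝ
  /-- the angular spread -/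
  Δ : ℝ
  /-- the mean angles of arrival of the users -/
  θ : Fin 2 → ℝ
  /-- the training powers of the users -/
  ρ : Fin 2 → ℝ
  /-- `φ u k` is the pilot phase of user `u` at symbol time `k` -/
  φ : Fin 2 → Fin 2 → ℝ

/-- The unitary `N × N` DFT matrix. -/
def dft (N : ℕ) : Matrix (Fin N) (Fin N) ℂ := Matrix.of fun p q =>
  Complex.exp (-(2 * Real.pi * Complex.I * (p : ℕ) * (q : ℕ) / N)) / (Real.sqrt N : ℂ)

namespace Setup

variable {N L : ℕ} (S : Setup N L)

/-- The number `s` of overlapping subcarriers. -/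
def s : ℕ := S.P.card

/-- The pilot matrix `X = [x₁ x₂]`: row = symbol time, column = user,
with entries `√ρ_u e^{jφ_{u,k}}`. -/
def X : Matrix (Fin 2) (Fin 2) ℂ := Matrix.of fun k u =>
  (Real.sqrt (S.ρ u) : ℂ) * Complex.exp (Complex.I * S.φ u k)

/-- The pilot vector of user `u` over the two symbol times. -/
def pilot (u : Fin 2) : Fin 2 → ℂ := fun k => S.X k u

/-- The rows indexed by `P` of the matrix formed by `√N` times the first `L` columns of the
DFT matrix (this needs `L ≤ N`). -/
def FLs (hL : L ≤ N) : Matrix S.P (Fin L) ℂ := Matrix.of fun p l =>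
  (Real.sqrt N : ℂ) * dft N p.1 (Fin.castLE hL l)

/-- The rows indexed by `P` of the DFT matrix. -/
def Fs : Matrix S.P (Fin N) ℂ := Matrix.of fun p q => dft N p.1 q

/-- `R_F = F_{L,s}ᵀ F_{L,s}^*`. -/
def RF (hL : L ≤ N) : Matrix (Fin L) (Fin L) ℂ :=
  (S.FLs hL)ᵀ * (S.FLs hL).map star

/-- The one-ring spatial covariance matrix of user `u` for `NT` antennas; every tap has
the normalised power `1 / L`. -/
def R (NT : ℕ) (u : Fin 2) : Matrix (Fin NT) (Fin NT) ℂ := Matrix.of fun m n =>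
  (1 / (2 * S.Δ * L) : ℂ) *
    ∫ t in (S.θ u - S.Δ)..(S.θ u + S.Δ),
      Complex.exp (-(2 * Real.pi * Complex.I * S.D * (((m : ℕ) : ℂ) - ((n : ℕ) : ℂ)) * Real.sin t))

/-- The constant `T_u = Tr(R_u) Tr(R_F) / (NT s)`. -/
def T (hL : L ≤ N) (NT : ℕ) (u : Fin 2) : ℂ :=
  (S.R NT u).trace * (S.RF hL).trace / ((NT : ℂ) * S.s)

variable {NT : ℕ}

/-- The `2 × NT·s` matrix of frequency-domain channels; row `u` belongs to user `u`, and consists of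
the vectors `F_{L,s} h_u^i` for the antennas `i`. Here `h u (i, l)` is tap `l` of the impulse
response from user `u` to antenna `i`. -/
def H (hL : L ≤ N) (h : Fin 2 → Fin NT × Fin L → ℂ) : Matrix (Fin 2) (Fin NT × S.P) ℂ :=
  Matrix.of fun u ip => (S.FLs hL *ᵥ fun l => h u (ip.1, l)) ip.2

/-- The `2 × NT·s` noise matrix; `w (i, k, q)` is the `q`-th time-domain noise sample
at antenna `i` and symbol time `k`. -/
def noise (w : Fin NT × Fin 2 × Fin N → ℂ) : Matrix (Fin 2) (Fin NT × S.P) ℂ :=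
  Matrix.of fun k ip => (S.Fs *ᵥ fun q => w (ip.1, k, q)) ip.2

/-- The received signal `Y = X H + N`. -/
def Y (hL : L ≤ N) (h : Fin 2 → Fin NT × Fin L → ℂ) (w : Fin NT × Fin 2 × Fin N → ℂ) :
    Matrix (Fin 2) (Fin NT × S.P) ℂ :=
  S.X * S.H hL h + S.noise w

/-- The sample covariance matrix `Y Yᴴ / (NT s)`. -/
def C (hL : L ≤ N) (h : Fin 2 → Fin NT × Fin L → ℂ) (w : Fin NT × Fin 2 × Fin N → ℂ) :
    Matrix (Fin 2) (Fin 2) ℂ :=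
  (1 / ((NT : ℂ) * S.s)) • (S.Y hL h w * (S.Y hL h w)ᴴ)

/-- The asymptotically optimal LMMSE estimator `W_u = T_u x_uᴴ C⁻¹` (a row vector). -/
def W (hL : L ≤ N) (u : Fin 2) (h : Fin 2 → Fin NT × Fin L → ℂ)
    (w : Fin NT × Fin 2 × Fin N → ℂ) : Fin 2 → ℂ :=
  S.T hL NT u • (star (S.pilot u) ᵥ* (S.C hL h w)⁻¹)

/-- The estimate `W_u Y` of the frequency-domain channel of user `u`. -/
def estimate (hL : L ≤ N) (u : Fin 2) (h : Fin 2 → Fin NT × Fin L → ℂ)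
    (w : Fin NT × Fin 2 × Fin N → ℂ) : Fin NT × S.P → ℂ :=
  S.W hL u h w ᵥ* S.Y hL h w

/-- The squared Euclidean norm of the estimation error of user `u`. -/
def sqError (hL : L ≤ N) (u : Fin 2) (h : Fin 2 → Fin NT × Fin L → ℂ)
    (w : Fin NT × Fin 2 × Fin N → ℂ) : ℝ :=
  ∑ ip, ‖S.estimate hL u h w ip - S.H hL h u ip‖ ^ 2

variable {Ω : Type*} [MeasurableSpace Ω]

/-- The random model for `NT` antennas and noise power `σ2`: for each user the taps are
independent, each tap is a circular Gaussian vector over the antennas with covariance `R_u`; the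
noise samples are independent `CN(0, σ2)`; both channels and the noise are independent. -/
structure IsModel (μ : Measure Ω) (NT : ℕ) (σ2 : ℝ) (h : Fin 2 → Fin NT × Fin L → Ω → ℂ)
    (w : Fin NT × Fin 2 × Fin N → Ω → ℂ) : Prop where
  channel : ∀ u, IsCircularGaussian μ (h u) (S.R NT u ⊗ₖ (1 : Matrix (Fin L) (Fin L) ℂ))
  noise : IsCircularGaussian μ w ((σ2 : ℂ) • (1 : Matrix _ _ ℂ))
  indep_channels : IndepFun (fun ω x => h 0 x ω) (fun ω x => h 1 x ω) μ
  indep_noise : IndepFun (fun ω u x => h u x ω) (fun ω x => w x ω) μ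

/-- The normalised mean square error `E‖ĥ_u - h_u‖² / (NT s)`. -/
def nmse (hL : L ≤ N) (μ : Measure Ω) (u : Fin 2) (h : Fin 2 → Fin NT × Fin L → Ω → ℂ)
    (w : Fin NT × Fin 2 × Fin N → Ω → ℂ) : ℝ :=
  (∫ ω, S.sqError hL u (fun v x => h v x ω) (fun x => w x ω) ∂μ) / ((NT : ℝ) * S.s)

end Setup

end

end PilotTraining

/-! ### Moments and characteristic function of the complex Gaussian law. -/

namespace PilotTraining

/-! The entries of `F_{L,s}` are unimodular and every tap has power `1 / L`, so `T_u = 1` for each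
`NT > 0` (`T_eq_one`). The squared error divided by `NT s` is then a fixed function `gramError` of
the normalised Gram matrix of the two rows of `Y` and the channel row. It remains to find the limit
of this Gram matrix, to pass to the limit in the expectation, and to compute.

Limit of the Gram matrix. A combination of the rows is a circular Gaussian vector, and the variance
of its squared norm is `tr Γ²`, where `Γ` is its covariance. After division by `(NT s)²` this tends
to `0`: the noise part of `Γ` is a multiple of the identity, and for the channel part the mean of
`|[R_u]_{m,n}|²` vanishes by Wiener's lemma, since `D sin θ` modulo `1` has no atoms
(`tendsto_mean_sq_R`). Polarisation extends mean-square convergence to all inner products; in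
particular `C` tends to `X Xᴴ + σ² I`.

Expectation. Convergence in measure does not suffice, because `C⁻¹` is unbounded. The normalised
error is at most `2 |xᴴ adj(C) x| / det C + 2 ‖h‖² / (NT s)`. The adjugate of a `2 × 2` matrix is
linear in its entries, so the numerator and the power converge in mean square; it is enough that `1
/ det C` is bounded in mean square uniformly in `NT`. Now `π² / det C` is the integral over `z ∈ ℂ²`
of the exponential of minus a Hermitian form, namely the normalised squared norm of the combination
`z₁ Y₀ + z₂ Y₁`. The noise makes the covariance of this combination at least `σ² ‖z‖² I`, which
bounds the Laplace transform of its squared norm (`integral_exp_neg_le`); a weighted Cauchy–Schwarz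
inequality concludes (`exists_lintegral_inv_det_sq_le`).

Computation. The limit is `1 - x_uᴴ (X Xᴴ + σ² I)⁻¹ x_u`, which equals `1 - (|det X|² + 2 ρ_u σ²) /
(|det X|² + 2 (ρ_0 + ρ_1) σ² + σ⁴)`. As `σ² → 0⁺` it tends to `0` for both users if `det X ≠ 0`, and
to `1 / 2` for both if `det X = 0` and the powers agree. -/

theorem integral_complexGaussian {E : Type*} [NormedAddCommGroup E] [NormedSpace ℝ E] (v : ℝ≥0)
    {f : ℂ → E} (hf : Continuous f) :
    ∫ z, f z ∂complexGaussian v =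
      ∫ p : ℝ × ℝ, f ((p.1 : ℂ) + (p.2 : ℂ) * Complex.I)
        ∂((gaussianReal 0 (v / 2)).prod (gaussianReal 0 (v / 2))) := by
  by_cases hE : CompleteSpace E
  · exact integral_map (by fun_prop) (by
      have : SecondCountableTopologyEither ℂ E := inferInstance
      exact hf.aestronglyMeasurable)
  -- Both Bochner integrals are `0` by convention when `E` is not complete.
  · simp [integral, hE]

instance (v : ℝ≥0) : IsProbabilityMeasure (complexGaussian v) := by
  unfold complexGaussian
  exact Measure.isProbabilityMeasure_map (by fun_prop)

theorem charFun_complexGaussian (v : ℝ≥0) (t : ℂ) :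
    charFun (complexGaussian v) t = Complex.exp (-(v * ‖t‖ ^ 2 / 4 : ℝ)) := by
  have h1 (a : ℝ) := charFun_gaussianReal (μ := 0) (v := v / 2) a
  simp only [charFun_apply_real] at h1
  rw [charFun_apply, integral_complexGaussian v (by fun_prop)]
  have : ∀ p : ℝ × ℝ, Complex.exp
      (((inner ℝ ((p.1 : ℂ) + (p.2 : ℂ) * Complex.I) t : ℝ) : ℂ) * Complex.I) =
      Complex.exp (t.re * p.1 * Complex.I) * Complex.exp (t.im * p.2 * Complex.I) := by
    intro p
    rw [← Complex.exp_add]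
    congr 1
    rw [Complex.inner]
    simp
    ring
  simp_rw [this]
  rw [integral_prod_mul (fun x : ℝ => Complex.exp (t.re * x * Complex.I))
    (fun x : ℝ => Complex.exp (t.im * x * Complex.I)), h1, h1, ← Complex.exp_add]
  congr 1
  rw [← Complex.normSq_eq_norm_sq, Complex.normSq_apply]
  push_cast
  ring

theorem complexGaussian_conv (v₁ v₂ : ℝ≥0) :
    (complexGaussian v₁) ∗ (complexGaussian v₂) = complexGaussian (v₁ + v₂) := by
  refine Measure.ext_of_charFun (funext fun t => ?_)
  rw [charFun_conv, charFun_complexGaussian, charFun_complexGaussian, charFun_complexGaussian,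
    ← Complex.exp_add]
  congr 1
  push_cast
  ring

theorem integral_pow_four_gaussianReal (v : ℝ≥0) :
    ∫ x, x ^ 4 ∂gaussianReal 0 v = 3 * (v : ℝ) ^ 2 := by
  -- The moment is the fourth derivative at `0` of `exp (v t² / 2)`; `d1` to `d4` differentiate one
  -- order at a time.
  have h0 : ∫ x, x ^ 4 ∂gaussianReal 0 v = iteratedDeriv 4 (mgf id (gaussianReal 0 v)) 0 := by
    rw [iteratedDeriv_mgf_zero (by simp [integrableExpSet_id_gaussianReal])]
    simp
  rw [h0, mgf_id_gaussianReal]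
  have e (t : ℝ) : HasDerivAt (fun t : ℝ => Real.exp (0 * t + v * t ^ 2 / 2))
      (v * t * Real.exp (0 * t + v * t ^ 2 / 2)) t := by
    have : HasDerivAt (fun t : ℝ => 0 * t + v * t ^ 2 / 2) (v * t) t := by
      have := ((hasDerivAt_id t).const_mul 0).add
        ((((hasDerivAt_id t).pow 2).const_mul (v : ℝ)).div_const 2)
      convert! this using 1
      simp
      ring
    convert! this.exp using 1
    ring
  have d1 : deriv (fun t : ℝ => Real.exp (0 * t + v * t ^ 2 / 2)) =
      fun t => v * t * Real.exp (0 * t + v * t ^ 2 / 2) := funext fun t => (e t).deriv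
  have d2 : deriv (fun t : ℝ => v * t * Real.exp (0 * t + v * t ^ 2 / 2)) =
      fun t => (v + v ^ 2 * t ^ 2) * Real.exp (0 * t + v * t ^ 2 / 2) := by
    funext t
    have := (((hasDerivAt_id t).const_mul (v : ℝ)).mul (e t)).deriv
    refine (Eq.trans ?_ this).trans ?_
    · rfl
    · simp; ring
  have d3 : deriv (fun t : ℝ => (v + v ^ 2 * t ^ 2) * Real.exp (0 * t + v * t ^ 2 / 2)) =
      fun t => (3 * v ^ 2 * t + v ^ 3 * t ^ 3) * Real.exp (0 * t + v * t ^ 2 / 2) := by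
    funext t
    have := (((((hasDerivAt_id t).pow 2).const_mul ((v : ℝ) ^ 2)).const_add (v : ℝ)).mul
      (e t)).deriv
    refine (Eq.trans ?_ this).trans ?_
    · rfl
    · simp; ring
  have d4 : deriv (fun t : ℝ => (3 * v ^ 2 * t + v ^ 3 * t ^ 3) *
      Real.exp (0 * t + v * t ^ 2 / 2)) 0 = 3 * (v : ℝ) ^ 2 := by
    have := ((((hasDerivAt_id (0 : ℝ)).const_mul (3 * (v : ℝ) ^ 2)).add
      (((hasDerivAt_id (0 : ℝ)).pow 3).const_mul ((v : ℝ) ^ 3))).mul (e 0)).deriv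
    refine (Eq.trans ?_ this).trans ?_
    · rfl
    · simp
  rw [iteratedDeriv_succ, iteratedDeriv_succ, iteratedDeriv_succ, iteratedDeriv_succ,
    iteratedDeriv_zero, d1, d2, d3, d4]

theorem integral_sq_gaussianReal (v : ℝ≥0) :
    ∫ x, x ^ 2 ∂gaussianReal 0 v = v := by
  have h := variance_id_gaussianReal (μ := 0) (v := v)
  rw [variance_of_integral_eq_zero (by fun_prop) (by simp)] at h
  simpa using h

theorem integrable_pow_gaussianReal (v : ℝ≥0) (k : ℕ) :
    Integrable (fun x : ℝ => x ^ k) (gaussianReal 0 v) := by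
  rcases Nat.eq_zero_or_pos k with rfl | hk
  · simp
  have := (memLp_id_gaussianReal (μ := 0) (v := v) k).integrable_norm_pow (by omega)
  refine (integrable_norm_iff (by fun_prop)).1 ?_
  simpa using this

theorem norm_add_mul_I_pow_four (p : ℝ × ℝ) :
    ‖(p.1 : ℂ) + (p.2 : ℂ) * Complex.I‖ ^ 4 =
      p.1 ^ 4 * p.2 ^ 0 + 2 * (p.1 ^ 2 * p.2 ^ 2) + p.1 ^ 0 * p.2 ^ 4 := by
  rw [show 4 = 2 * 2 from rfl, pow_mul, ← Complex.normSq_eq_norm_sq, Complex.normSq_add_mul_I]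
  ring

theorem integrable_norm_pow_four_complexGaussian (v : ℝ≥0) :
    Integrable (fun z : ℂ => ‖z‖ ^ 4) (complexGaussian v) := by
  have hi (j k : ℕ) : Integrable (fun p : ℝ × ℝ => p.1 ^ j * p.2 ^ k)
      ((gaussianReal 0 (v / 2)).prod (gaussianReal 0 (v / 2))) :=
    (integrable_pow_gaussianReal _ j).mul_prod (integrable_pow_gaussianReal _ k)
  unfold complexGaussian
  rw [integrable_map_measure (by fun_prop) (by fun_prop)]
  refine (((hi 4 0).add ((hi 2 2).const_mul 2)).add (hi 0 4)).congr (ae_of_all _ fun p => ?_)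
  simpa using (norm_add_mul_I_pow_four p).symm

theorem integral_norm_pow_four_complexGaussian (v : ℝ≥0) :
    ∫ z, ‖z‖ ^ 4 ∂complexGaussian v = 2 * (v : ℝ) ^ 2 := by
  have hi (j k : ℕ) : Integrable (fun p : ℝ × ℝ => p.1 ^ j * p.2 ^ k)
      ((gaussianReal 0 (v / 2)).prod (gaussianReal 0 (v / 2))) :=
    (integrable_pow_gaussianReal _ j).mul_prod (integrable_pow_gaussianReal _ k)
  rw [integral_complexGaussian v (by fun_prop)]
  simp_rw [norm_add_mul_I_pow_four]
  have h42 : Integrable (fun p : ℝ × ℝ => p.1 ^ 4 * p.2 ^ 0 + 2 * (p.1 ^ 2 * p.2 ^ 2))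
      ((gaussianReal 0 (v / 2)).prod (gaussianReal 0 (v / 2))) :=
    (hi 4 0).add ((hi 2 2).const_mul 2)
  rw [integral_add h42 (hi 0 4),
    integral_add (hi 4 0) ((hi 2 2).const_mul 2), integral_const_mul,
    integral_prod_mul (fun x : ℝ => x ^ 4) (fun x : ℝ => x ^ 0),
    integral_prod_mul (fun x : ℝ => x ^ 2) (fun x : ℝ => x ^ 2),
    integral_prod_mul (fun x : ℝ => x ^ 0) (fun x : ℝ => x ^ 4),
    integral_pow_four_gaussianReal, integral_sq_gaussianReal]
  simp
  ring

theorem integral_norm_sq_complexGaussian (v : ℝ≥0) :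
    ∫ z, ‖z‖ ^ 2 ∂complexGaussian v = v := by
  have hi (j k : ℕ) : Integrable (fun p : ℝ × ℝ => p.1 ^ j * p.2 ^ k)
      ((gaussianReal 0 (v / 2)).prod (gaussianReal 0 (v / 2))) :=
    (integrable_pow_gaussianReal _ j).mul_prod (integrable_pow_gaussianReal _ k)
  rw [integral_complexGaussian v (by fun_prop)]
  have (p : ℝ × ℝ) : ‖(p.1 : ℂ) + (p.2 : ℂ) * Complex.I‖ ^ 2 =
      p.1 ^ 2 * p.2 ^ 0 + p.1 ^ 0 * p.2 ^ 2 := by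
    rw [← Complex.normSq_eq_norm_sq, Complex.normSq_add_mul_I]
    ring
  simp_rw [this]
  rw [integral_add (hi 2 0) (hi 0 2),
    integral_prod_mul (fun x : ℝ => x ^ 2) (fun x : ℝ => x ^ 0),
    integral_prod_mul (fun x : ℝ => x ^ 0) (fun x : ℝ => x ^ 2), integral_sq_gaussianReal]
  simp

end PilotTraining

/-! ### Circular Gaussian vectors: closure properties and fourth moments. -/

namespace PilotTraining

section CircularGaussian

variable {Ω : Type*} [MeasurableSpace Ω] {μ : Measure Ω} {ι κ : Type*} [Fintype ι] [Fintype κ]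

/-- Gaussianity is tested on linear forms, so the form `a` on the image is the form `a ᵥ* A` on the
source. -/
theorem IsCircularGaussian.linear_map {f : ι → Ω → ℂ} {Γ : Matrix ι ι ℂ}
    (hf : IsCircularGaussian μ f Γ) (A : Matrix κ ι ℂ) :
    IsCircularGaussian μ (fun k ω => ∑ i, A k i * f i ω) (A * Γ * Aᴴ) := by
  intro a
  obtain ⟨v, hv, hl⟩ := hf (a ᵥ* A)
  refine ⟨v, ?_, ?_⟩
  · have e1 : ∑ i, ∑ j, (a ᵥ* A) i * Γ i j * star ((a ᵥ* A) j) =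
        ((a ᵥ* A) ᵥ* Γ) ⬝ᵥ star (a ᵥ* A) := by
      simp only [Matrix.vecMul, dotProduct, Finset.sum_mul, Pi.star_apply]
      rw [Finset.sum_comm]
    have e2 : ∑ i, ∑ j, a i * (A * Γ * Aᴴ) i j * star (a j) =
        (a ᵥ* (A * Γ * Aᴴ)) ⬝ᵥ star a := by
      rw [Finset.sum_comm]
      simp only [Matrix.vecMul, dotProduct, Finset.sum_mul, Pi.star_apply]
    rw [hv, e1, e2, Matrix.star_vecMul, Matrix.dotProduct_mulVec, Matrix.vecMul_vecMul,
      Matrix.vecMul_vecMul, Matrix.mul_assoc]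
  · convert! hl using 2
    simp only [Matrix.vecMul, dotProduct, Finset.mul_sum, Finset.sum_mul]
    rw [Finset.sum_comm]
    simp only [mul_assoc]

theorem IsCircularGaussian.add_of_indepFun [IsFiniteMeasure μ] {f g : ι → Ω → ℂ}
    {Γ Γ' : Matrix ι ι ℂ}
    (hf : IsCircularGaussian μ f Γ) (hg : IsCircularGaussian μ g Γ')
    (hfg : IndepFun (fun ω i => f i ω) (fun ω i => g i ω) μ) :
    IsCircularGaussian μ (fun i ω => f i ω + g i ω) (Γ + Γ') := by
  intro a
  obtain ⟨v, hv, hl⟩ := hf a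
  obtain ⟨v', hv', hl'⟩ := hg a
  refine ⟨v + v', ?_, ?_⟩
  · push_cast
    rw [hv, hv', ← Finset.sum_add_distrib]
    refine Finset.sum_congr rfl fun i _ => ?_
    rw [← Finset.sum_add_distrib]
    refine Finset.sum_congr rfl fun j _ => ?_
    rw [Matrix.add_apply]
    ring
  · have hm : Measurable (fun x : ι → ℂ => ∑ i, a i * x i) := by fun_prop
    have := IndepFun.hasLaw_add hl hl' (hfg.comp hm hm)
    rw [complexGaussian_conv] at this
    convert! this using 2 with ω
    simp [mul_add, Finset.sum_add_distrib]

theorem IsCircularGaussian.aemeasurable {f : ι → Ω → ℂ} {Γ : Matrix ι ι ℂ}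
    (hf : IsCircularGaussian μ f Γ) (i : ι) : AEMeasurable (f i) μ := by
  classical
  obtain ⟨v, -, hl⟩ := hf (Pi.single i 1)
  convert! hl.aemeasurable using 2
  simp [Pi.single_apply]

theorem sum_sum_mul_pair [DecidableEq ι] (Γ : Matrix ι ι ℂ) (j k : ι) (c : ℂ) :
    ∑ x, ∑ y, (Pi.single j 1 + c • Pi.single k 1 : ι → ℂ) x * Γ x y *
      star ((Pi.single j 1 + c • Pi.single k 1 : ι → ℂ) y) =
      Γ j j + star c * Γ j k + c * Γ k j + c * star c * Γ k k := by
  simp [Pi.single_apply, add_mul, mul_add, Finset.sum_add_distrib, apply_ite (star : ℂ → ℂ)]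
  ring

/-- These two-term forms are the only ones needed for second and fourth moments; `c = 0` gives a
single coordinate. -/
theorem IsCircularGaussian.hasLaw_add_smul {f : ι → Ω → ℂ} {Γ : Matrix ι ι ℂ}
    (hf : IsCircularGaussian μ f Γ) (j k : ι) (c : ℂ) :
    ∃ v : ℝ≥0, (((v : ℝ) : ℂ) = Γ j j + star c * Γ j k + c * Γ k j + c * star c * Γ k k) ∧
      HasLaw (fun ω => f j ω + c * f k ω) (complexGaussian v) μ := by
  classical
  obtain ⟨v, hv, hl⟩ := hf (Pi.single j 1 + c • Pi.single k 1)
  refine ⟨v, hv.trans (sum_sum_mul_pair Γ j k c), ?_⟩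
  convert! hl using 2
  simp [Pi.single_apply, add_mul, Finset.sum_add_distrib]

theorem HasLaw.integral_norm_pow_four {X : Ω → ℂ} {v : ℝ≥0} (h : HasLaw X (complexGaussian v) μ) :
    ∫ ω, ‖X ω‖ ^ 4 ∂μ = 2 * (v : ℝ) ^ 2 := by
  rw [← integral_norm_pow_four_complexGaussian, ← h.map_eq,
    integral_map h.aemeasurable (by fun_prop)]

theorem HasLaw.integrable_norm_pow_four {X : Ω → ℂ} {v : ℝ≥0}
    (h : HasLaw X (complexGaussian v) μ) : Integrable (fun ω => ‖X ω‖ ^ 4) μ := by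
  have := integrable_norm_pow_four_complexGaussian v
  rw [← h.map_eq, integrable_map_measure (by fun_prop) h.aemeasurable] at this
  exact this

theorem IsCircularGaussian.integral_norm_sq {f : ι → Ω → ℂ} {Γ : Matrix ι ι ℂ}
    (hf : IsCircularGaussian μ f Γ) (i : ι) :
    ((∫ ω, ‖f i ω‖ ^ 2 ∂μ : ℝ) : ℂ) = Γ i i := by
  obtain ⟨v, hv, hl⟩ := hf.hasLaw_add_smul i i 0
  simp only [zero_mul, add_zero, star_zero] at hv hl
  rw [← hv, ← integral_norm_sq_complexGaussian, ← hl.map_eq,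
    integral_map hl.aemeasurable (by fun_prop)]

theorem IsCircularGaussian.memLp {f : ι → Ω → ℂ} {Γ : Matrix ι ι ℂ}
    (hf : IsCircularGaussian μ f Γ) (i : ι) : MemLp (f i) 4 μ := by
  obtain ⟨v, hv, hl⟩ := hf.hasLaw_add_smul i i 0
  simp only [zero_mul, add_zero] at hl
  have := HasLaw.integrable_norm_pow_four hl
  rw [← integrable_norm_rpow_iff hl.aemeasurable.aestronglyMeasurable (by simp) (by simp)]
  convert! this using 2
  norm_num

theorem IsCircularGaussian.memLp_norm_sq {f : ι → Ω → ℂ} {Γ : Matrix ι ι ℂ}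
    (hf : IsCircularGaussian μ f Γ) (i : ι) : MemLp (fun ω => ‖f i ω‖ ^ 2) 2 μ := by
  rw [memLp_two_iff_integrable_sq (by exact (hf.memLp i).1.norm.pow 2)]
  obtain ⟨v, hv, hl⟩ := hf.hasLaw_add_smul i i 0
  simp only [zero_mul, add_zero] at hl
  convert! HasLaw.integrable_norm_pow_four hl using 2
  ring

/-- Summing `|a + c b|⁴` over the fourth roots of unity `c` kills the odd cross terms. This reduces
a mixed moment to fourth moments of single complex Gaussians; the factors `1 *` and `0 *` keep the
shape of `hasLaw_add_smul`. -/
theorem four_mul_norm_sq_mul_norm_sq (a b : ℂ) :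
    16 * (‖a‖ ^ 2 * ‖b‖ ^ 2) = ‖a + 1 * b‖ ^ 4 + ‖a + (-1) * b‖ ^ 4 + ‖a + Complex.I * b‖ ^ 4 +
      ‖a + -Complex.I * b‖ ^ 4 - 4 * ‖a + 0 * b‖ ^ 4 - 4 * ‖b + 0 * b‖ ^ 4 := by
  simp only [show (4 : ℕ) = 2 * 2 from rfl, pow_mul, ← Complex.normSq_eq_norm_sq,
    Complex.normSq_apply]
  simp
  ring

theorem IsCircularGaussian.integral_norm_sq_mul_norm_sq {f : ι → Ω → ℂ} {Γ : Matrix ι ι ℂ}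
    (hf : IsCircularGaussian μ f Γ) (j k : ι) :
    ((∫ ω, ‖f j ω‖ ^ 2 * ‖f k ω‖ ^ 2 ∂μ : ℝ) : ℂ) = Γ j j * Γ k k + Γ j k * Γ k j := by
  obtain ⟨v1, h1, l1⟩ := hf.hasLaw_add_smul j k 1
  obtain ⟨v2, h2, l2⟩ := hf.hasLaw_add_smul j k (-1)
  obtain ⟨v3, h3, l3⟩ := hf.hasLaw_add_smul j k Complex.I
  obtain ⟨v4, h4, l4⟩ := hf.hasLaw_add_smul j k (-Complex.I)
  obtain ⟨v5, h5, l5⟩ := hf.hasLaw_add_smul j k 0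
  obtain ⟨v6, h6, l6⟩ := hf.hasLaw_add_smul k k 0
  have key : 16 * ∫ ω, ‖f j ω‖ ^ 2 * ‖f k ω‖ ^ 2 ∂μ =
      2 * (v1 : ℝ) ^ 2 + 2 * (v2 : ℝ) ^ 2 + 2 * (v3 : ℝ) ^ 2 + 2 * (v4 : ℝ) ^ 2
        - 4 * (2 * (v5 : ℝ) ^ 2) - 4 * (2 * (v6 : ℝ) ^ 2) := by
    rw [← integral_const_mul]
    simp_rw [four_mul_norm_sq_mul_norm_sq]
    have i1 := HasLaw.integrable_norm_pow_four l1
    have i2 := HasLaw.integrable_norm_pow_four l2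
    have i3 := HasLaw.integrable_norm_pow_four l3
    have i4 := HasLaw.integrable_norm_pow_four l4
    have i5 := (HasLaw.integrable_norm_pow_four l5).const_mul 4
    have i6 := (HasLaw.integrable_norm_pow_four l6).const_mul 4
    rw [integral_sub (by exact ((((i1.add i2).add i3).add i4).sub i5)) i6,
      integral_sub (by exact (((i1.add i2).add i3).add i4)) i5,
      integral_add (by exact ((i1.add i2).add i3)) i4, integral_add (by exact (i1.add i2)) i3,
      integral_add i1 i2, integral_const_mul, integral_const_mul,
      HasLaw.integral_norm_pow_four l1, HasLaw.integral_norm_pow_four l2,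
      HasLaw.integral_norm_pow_four l3, HasLaw.integral_norm_pow_four l4,
      HasLaw.integral_norm_pow_four l5, HasLaw.integral_norm_pow_four l6]
  have key' := congrArg (fun x : ℝ => (x : ℂ)) key
  push_cast at key'
  rw [h1, h2, h3, h4, h5, h6] at key'
  simp only [star_one, star_neg, star_zero, RCLike.star_def, Complex.conj_I] at key'
  have hI := Complex.I_sq
  have hI4 : Complex.I ^ 4 = 1 := Complex.I_pow_four
  have hI3 : Complex.I ^ 3 = -Complex.I := Complex.I_pow_three
  have : (16 : ℂ) * ((∫ ω, ‖f j ω‖ ^ 2 * ‖f k ω‖ ^ 2 ∂μ : ℝ) : ℂ) =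
      16 * (Γ j j * Γ k k + Γ j k * Γ k j) := by
    rw [key']
    ring_nf
    rw [hI4, hI]
    ring
  exact mul_left_cancel₀ (by norm_num) this

/-- The variance of the squared norm of a circular Gaussian vector is `tr Γ²`. -/
theorem IsCircularGaussian.integral_sum_norm_sq_sub_trace_sq [IsProbabilityMeasure μ]
    {f : ι → Ω → ℂ} {Γ : Matrix ι ι ℂ}
    (hf : IsCircularGaussian μ f Γ) :
    ((∫ ω, (∑ i, ‖f i ω‖ ^ 2 - Γ.trace.re) ^ 2 ∂μ : ℝ) : ℂ) = ∑ j, ∑ k, Γ j k * Γ k j := by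
  have hd (i : ι) : ((Γ i i).re : ℂ) = Γ i i := by
    rw [← hf.integral_norm_sq i, Complex.ofReal_re]
  have hint (j k : ι) : Integrable
      (fun ω => (‖f j ω‖ ^ 2 - (Γ j j).re) * (‖f k ω‖ ^ 2 - (Γ k k).re)) μ :=
    ((hf.memLp_norm_sq j).sub (memLp_const _)).integrable_mul
      ((hf.memLp_norm_sq k).sub (memLp_const _))
  have h1 (ω : Ω) : (∑ i, ‖f i ω‖ ^ 2 - Γ.trace.re) ^ 2 =
      ∑ j, ∑ k, (‖f j ω‖ ^ 2 - (Γ j j).re) * (‖f k ω‖ ^ 2 - (Γ k k).re) := by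
    rw [← Finset.sum_mul_sum, Finset.sum_sub_distrib, Matrix.trace, Complex.re_sum, sq]
    rfl
  simp_rw [h1]
  rw [integral_finsetSum _ fun j _ => integrable_finsetSum _ fun k _ => hint j k]
  push_cast
  refine Finset.sum_congr rfl fun j _ => ?_
  rw [integral_finsetSum _ fun k _ => hint j k]
  push_cast
  refine Finset.sum_congr rfl fun k _ => ?_
  have hj := (hf.memLp_norm_sq j).integrable one_le_two
  have hk := (hf.memLp_norm_sq k).integrable one_le_two
  have hjk : Integrable (fun ω => ‖f j ω‖ ^ 2 * ‖f k ω‖ ^ 2) μ :=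
    (hf.memLp_norm_sq j).integrable_mul (hf.memLp_norm_sq k)
  have h2 : ∫ ω, (‖f j ω‖ ^ 2 - (Γ j j).re) * (‖f k ω‖ ^ 2 - (Γ k k).re) ∂μ =
      ∫ ω, ‖f j ω‖ ^ 2 * ‖f k ω‖ ^ 2 ∂μ - (Γ k k).re * ∫ ω, ‖f j ω‖ ^ 2 ∂μ
        - (Γ j j).re * ∫ ω, ‖f k ω‖ ^ 2 ∂μ + (Γ j j).re * (Γ k k).re := by
    have (ω : Ω) : (‖f j ω‖ ^ 2 - (Γ j j).re) * (‖f k ω‖ ^ 2 - (Γ k k).re) =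
      ‖f j ω‖ ^ 2 * ‖f k ω‖ ^ 2 - (Γ k k).re * ‖f j ω‖ ^ 2
        - (Γ j j).re * ‖f k ω‖ ^ 2 + (Γ j j).re * (Γ k k).re := by ring
    simp_rw [this]
    rw [integral_add (by exact ((hjk.sub (hj.const_mul _)).sub (hk.const_mul _)))
      (integrable_const _), integral_sub (by exact (hjk.sub (hj.const_mul _))) (hk.const_mul _),
      integral_sub hjk (hj.const_mul _), integral_const_mul, integral_const_mul]
    simp
  rw [h2]
  push_cast
  rw [hf.integral_norm_sq_mul_norm_sq, hf.integral_norm_sq, hf.integral_norm_sq, hd, hd]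
  ring

end CircularGaussian

end PilotTraining

/-! ### Covariances of the frequency-domain channels and noise. -/

namespace PilotTraining

theorem dft_mul_conjTranspose {N : ℕ} (hN : N ≠ 0) : dft N * (dft N)ᴴ = 1 := by
  ext p q
  have hN' : (N : ℂ) ≠ 0 := by exact_mod_cast hN
  have hs : (Real.sqrt N : ℂ) * (Real.sqrt N : ℂ) = N := by
    rw [← Complex.ofReal_mul, Real.mul_self_sqrt (by positivity)]
    simp
  set z : ℂ := Complex.exp (2 * Real.pi * Complex.I * (((q : ℕ) : ℂ) - ((p : ℕ) : ℂ)) / N)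
    with hz
  have hterm (k : Fin N) : dft N p k * star (dft N q k) = z ^ (k : ℕ) / N := by
    simp only [dft, Matrix.of_apply, star_div₀, RCLike.star_def, Complex.conj_ofReal,
      ← Complex.exp_conj]
    rw [div_mul_div_comm, hs, ← Complex.exp_add, hz, ← Complex.exp_nat_mul]
    congr 2
    simp only [map_neg, map_mul, map_div₀, Complex.conj_I, Complex.conj_ofReal, map_natCast,
      map_ofNat]
    ring
  rw [Matrix.mul_apply]
  simp only [Matrix.conjTranspose_apply, hterm]
  rw [← Finset.sum_div, Fin.sum_univ_eq_sum_range (fun k => z ^ k)]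
  by_cases hpq : p = q
  · subst hpq
    simp [hz, hN']
  · rw [Matrix.one_apply_ne hpq]
    -- Equality would make `q - p` a multiple of `N`, impossible for distinct indices in `[0, N)`.
    -- The geometric sum below then vanishes because `z ^ N = 1`.
    have hz1 : z ≠ 1 := by
      rw [hz, Ne, Complex.exp_eq_one_iff]
      rintro ⟨m, hm⟩
      have h2 : (2 * Real.pi * Complex.I : ℂ) ≠ 0 := Complex.two_pi_I_ne_zero
      have h3 : (((q : ℕ) : ℂ) - ((p : ℕ) : ℂ)) = m * N := by
        field_simp at hm
        linear_combination hm
      have h4 : ((q : ℕ) : ℤ) - ((p : ℕ) : ℤ) = m * N := by exact_mod_cast h3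
      have hp := p.2
      have hq := q.2
      have h5 : m = 0 := by
        rcases lt_trichotomy m 0 with h | h | h
        · nlinarith
        · exact h
        · nlinarith
      rw [h5] at h4
      exact hpq (Fin.ext (by omega))
    rw [geom_sum_eq hz1, hz, ← Complex.exp_nat_mul]
    have : (N : ℂ) * (2 * Real.pi * Complex.I * (((q : ℕ) : ℂ) - ((p : ℕ) : ℂ)) / N) =
        (((q : ℤ) - (p : ℤ) : ℤ) : ℂ) * (2 * Real.pi * Complex.I) := by
      push_cast
      field_simp
    rw [this, Complex.exp_int_mul_two_pi_mul_I]
    simp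

namespace Setup

variable {N L : ℕ} (S : Setup N L)

theorem Fs_mul_conjTranspose : S.Fs * S.Fsᴴ = 1 := by
  ext p q
  have hN : N ≠ 0 := fun h => by
    subst h
    exact p.1.elim0
  have := congrFun (congrFun (dft_mul_conjTranspose hN) p.1) q.1
  rw [Matrix.mul_apply] at this ⊢
  simp only [Matrix.conjTranspose_apply, Fs, Matrix.of_apply] at this ⊢
  rw [this, Matrix.one_apply, Matrix.one_apply]
  simp only [Subtype.ext_iff]

theorem norm_FLs (hL : L ≤ N) (p : S.P) (l : Fin L) : ‖S.FLs hL p l‖ = 1 := by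
  have hN : 0 < N := p.1.pos
  have : (Real.sqrt N : ℂ) ≠ 0 := by
    simpa using (Real.sqrt_pos.2 (by exact_mod_cast hN : (0 : ℝ) < N)).ne'
  simp only [FLs, dft, Matrix.of_apply]
  rw [mul_div_cancel₀ _ this]
  convert! Complex.norm_exp_ofReal_mul_I
    (-(2 * Real.pi * ((p : Fin N) : ℕ) * ((Fin.castLE hL l : Fin N) : ℕ) / N)) using 3
  push_cast
  ring

theorem FLs_mul_star (hL : L ≤ N) (p : S.P) (l : Fin L) :
    S.FLs hL p l * star (S.FLs hL p l) = 1 := by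
  rw [RCLike.star_def, Complex.mul_conj, Complex.normSq_eq_norm_sq, norm_FLs]
  simp

theorem trace_RF (hL : L ≤ N) : (S.RF hL).trace = L * S.s := by
  simp only [RF, Matrix.trace, Matrix.diag, Matrix.mul_apply, Matrix.transpose_apply,
    Matrix.map_apply, FLs_mul_star]
  simp [s]

theorem R_self (hΔ : 0 < S.Δ) (NT : ℕ) (u : Fin 2) (m : Fin NT) : S.R NT u m m = 1 / L := by
  have : (S.Δ : ℂ) ≠ 0 := by exact_mod_cast hΔ.ne'
  simp only [R, Matrix.of_apply, sub_self, mul_zero, zero_mul, neg_zero, Complex.exp_zero]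
  rw [intervalIntegral.integral_const]
  simp only [Complex.real_smul]
  push_cast
  rcases eq_or_ne (L : ℂ) 0 with h | h
  · simp [h]
  · field_simp
    ring

/-- The traces are `NT / L` and `L s`, so the normalisation is exact for every positive `NT`, not
only asymptotically. -/
theorem T_eq_one (hL0 : 0 < L) (hL : L ≤ N) (hP : S.P.Nonempty) (hΔ : 0 < S.Δ) {NT : ℕ}
    (hNT : 0 < NT) (u : Fin 2) : S.T hL NT u = 1 := by
  have h1 : (L : ℂ) ≠ 0 := by exact_mod_cast hL0.ne'
  have h2 : (NT : ℂ) ≠ 0 := by exact_mod_cast hNT.ne'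
  have h3 : (S.s : ℂ) ≠ 0 := by exact_mod_cast hP.card_pos.ne'
  rw [T, trace_RF, Matrix.trace]
  simp only [Matrix.diag, S.R_self hΔ]
  simp
  field_simp

variable {NT : ℕ}

/-- The combination with coefficients `a` and `c` of the rows of the channel and noise matrices. -/
noncomputable def rowComb (hL : L ≤ N) (a c : Fin 2 → ℂ) (h : Fin 2 → Fin NT × Fin L → ℂ)
    (w : Fin NT × Fin 2 × Fin N → ℂ) : Fin NT × S.P → ℂ := fun x =>
  ∑ u, a u * S.H hL h u x + ∑ k, c k * S.noise w k x

/-- The covariance matrix of the channel part of `rowComb`. -/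
noncomputable def channelCov (hL : L ≤ N) (NT : ℕ) (a : Fin 2 → ℂ) :
    Matrix (Fin NT × S.P) (Fin NT × S.P) ℂ :=
  (a 0 * star (a 0)) • S.R NT 0 ⊗ₖ (S.FLs hL * (S.FLs hL)ᴴ) +
    (a 1 * star (a 1)) • S.R NT 1 ⊗ₖ (S.FLs hL * (S.FLs hL)ᴴ)

variable {Ω : Type*} [MeasurableSpace Ω] {μ : Measure Ω} {σ2 : ℝ}
  {h : Fin 2 → Fin NT × Fin L → Ω → ℂ} {w : Fin NT × Fin 2 × Fin N → Ω → ℂ}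

/-- Writing the channel row as the image of the taps under `b • (1 ⊗ₖ F_{L,s})` makes `linear_map`
applicable; the mixed product rule then gives the covariance `|b|² R_u ⊗ₖ F_{L,s} F_{L,s}ᴴ`. -/
theorem H_apply_eq_sum (hL : L ≤ N) (h : Fin 2 → Fin NT × Fin L → ℂ) (u : Fin 2) (b : ℂ)
    (x : Fin NT × S.P) :
    b * S.H hL h u x = ∑ y, (b • (1 : Matrix (Fin NT) (Fin NT) ℂ) ⊗ₖ S.FLs hL) x y * h u y := by
  rw [Fintype.sum_prod_type]
  simp [H, Matrix.mulVec, dotProduct, Matrix.one_apply, Finset.mul_sum, mul_assoc]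

theorem noise_sum_eq (w : Fin NT × Fin 2 × Fin N → ℂ) (c : Fin 2 → ℂ) (x : Fin NT × S.P) :
    ∑ k, c k * S.noise w k x = ∑ y, ((1 : Matrix (Fin NT) (Fin NT) ℂ) ⊗ₖ
      (Matrix.of fun (p : S.P) (kq : Fin 2 × Fin N) => c kq.1 * S.Fs p kq.2)) x y * w y := by
  rw [Fintype.sum_prod_type]
  simp only [Fintype.sum_prod_type (f := fun y : Fin 2 × Fin N => _)]
  simp [noise, Matrix.mulVec, dotProduct, Matrix.one_apply, Finset.mul_sum, mul_assoc]

theorem IsModel.isCircularGaussian_H (hm : S.IsModel μ NT σ2 h w) (hL : L ≤ N) (u : Fin 2)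
    (b : ℂ) :
    IsCircularGaussian μ (fun x ω => b * S.H hL (fun v y => h v y ω) u x)
      ((b * star b) • S.R NT u ⊗ₖ (S.FLs hL * (S.FLs hL)ᴴ)) := by
  have := (hm.channel u).linear_map (b • (1 : Matrix (Fin NT) (Fin NT) ℂ) ⊗ₖ S.FLs hL)
  simp only [H_apply_eq_sum]
  convert! this using 1
  rw [Matrix.conjTranspose_smul, Matrix.conjTranspose_kronecker, Matrix.conjTranspose_one,
    Matrix.smul_mul, Matrix.smul_mul, Matrix.mul_smul, smul_smul,
    ← Matrix.mul_kronecker_mul, ← Matrix.mul_kronecker_mul]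
  simp

theorem IsModel.isCircularGaussian_noise (hm : S.IsModel μ NT σ2 h w) (c : Fin 2 → ℂ) :
    IsCircularGaussian μ (fun x ω => ∑ k, c k * S.noise (fun y => w y ω) k x)
      (((σ2 : ℂ) * ∑ k, c k * star (c k)) •
        (1 : Matrix (Fin NT × S.P) (Fin NT × S.P) ℂ)) := by
  have := hm.noise.linear_map ((1 : Matrix (Fin NT) (Fin NT) ℂ) ⊗ₖ
      (Matrix.of fun (p : S.P) (kq : Fin 2 × Fin N) => c kq.1 * S.Fs p kq.2))
  simp only [noise_sum_eq]
  convert! this using 1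
  rw [Matrix.conjTranspose_kronecker, Matrix.conjTranspose_one, Matrix.mul_smul, Matrix.mul_one,
    Matrix.smul_mul, ← Matrix.mul_kronecker_mul, Matrix.mul_one, mul_smul]
  congr 1
  -- The selected rows of the DFT matrix are orthonormal, so the noise stays white in the frequency
  -- domain.
  have : (Matrix.of fun (p : S.P) (kq : Fin 2 × Fin N) => c kq.1 * S.Fs p kq.2) *
      (Matrix.of fun (p : S.P) (kq : Fin 2 × Fin N) => c kq.1 * S.Fs p kq.2)ᴴ =
      (∑ k, c k * star (c k)) • (1 : Matrix S.P S.P ℂ) := by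
    rw [← Fs_mul_conjTranspose]
    ext p q
    simp only [Matrix.mul_apply, Matrix.conjTranspose_apply, Matrix.of_apply,
      Matrix.smul_apply, smul_eq_mul, Fintype.sum_prod_type, Finset.sum_mul_sum, star_mul']
    exact Finset.sum_congr rfl fun _ _ => Finset.sum_congr rfl fun _ _ => by ring
  rw [this, Matrix.kronecker_smul, Matrix.one_kronecker_one]

theorem measurable_H (hL : L ≤ N) (u : Fin 2) (x : Fin NT × S.P) :
    Measurable fun h : Fin 2 → Fin NT × Fin L → ℂ => S.H hL h u x := by
  simp only [H, Matrix.of_apply, Matrix.mulVec, dotProduct]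
  fun_prop

theorem measurable_noise (k : Fin 2) (x : Fin NT × S.P) :
    Measurable fun w : Fin NT × Fin 2 × Fin N → ℂ => S.noise w k x := by
  simp only [Setup.noise, Matrix.of_apply, Matrix.mulVec, dotProduct]
  fun_prop

theorem IsModel.isCircularGaussian_channel [IsProbabilityMeasure μ]
    (hm : S.IsModel μ NT σ2 h w) (hL : L ≤ N) (a : Fin 2 → ℂ) :
    IsCircularGaussian μ (fun x ω => ∑ u, a u * S.H hL (fun v y => h v y ω) u x)
      (S.channelCov hL NT a) := by
  have h0 := hm.isCircularGaussian_H S hL 0 (a 0)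
  have h1 := hm.isCircularGaussian_H S hL 1 (a 1)
  have hmeas (u : Fin 2) : Measurable fun (g : Fin NT × Fin L → ℂ) (x : Fin NT × S.P) =>
      a u * S.H hL (fun _ => g) u x :=
    measurable_pi_lambda _ fun x => ((S.measurable_H hL u x).comp
      (measurable_pi_lambda _ fun _ => measurable_id)).const_mul _
  have := h0.add_of_indepFun h1 (by
    have := hm.indep_channels.comp (hmeas 0) (hmeas 1)
    exact this)
  simpa [Fin.sum_univ_two, channelCov] using this

theorem IsModel.isCircularGaussian_rowComb [IsProbabilityMeasure μ]
    (hm : S.IsModel μ NT σ2 h w) (hL : L ≤ N) (a c : Fin 2 → ℂ) :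
    IsCircularGaussian μ
      (fun x ω => S.rowComb hL a c (fun v y => h v y ω) (fun y => w y ω) x)
      (S.channelCov hL NT a + ((σ2 : ℂ) * ∑ k, c k * star (c k)) • 1) := by
  refine (hm.isCircularGaussian_channel S hL a).add_of_indepFun
    (hm.isCircularGaussian_noise S c) ?_
  have h1 : Measurable fun (g : Fin 2 → Fin NT × Fin L → ℂ) (x : Fin NT × S.P) =>
      ∑ u, a u * S.H hL g u x :=
    measurable_pi_lambda _ fun x => Finset.measurable_sum _ fun u _ =>
      (S.measurable_H hL u x).const_mul _
  have h2 : Measurable fun (g : Fin NT × Fin 2 × Fin N → ℂ) (x : Fin NT × S.P) =>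
      ∑ k, c k * S.noise g k x :=
    measurable_pi_lambda _ fun x => Finset.measurable_sum _ fun k _ =>
      (S.measurable_noise k x).const_mul _
  exact hm.indep_noise.comp h1 h2

end Setup

end PilotTraining

/-! ### Decay of the spatial covariance: Wiener's lemma. -/

namespace PilotTraining

theorem countable_setOf_sin_eq (c : ℝ) : {t : ℝ | Real.sin t = c}.Countable := by
  by_cases hc : ∃ t, Real.sin t = c
  · obtain ⟨t₀, rfl⟩ := hc
    have : {t : ℝ | Real.sin t = Real.sin t₀} ⊆
        (Set.range fun k : ℤ => 2 * (k : ℝ) * Real.pi + t₀) ∪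
          Set.range fun k : ℤ => (2 * (k : ℝ) + 1) * Real.pi - t₀ := by
      intro t ht
      obtain ⟨k, hk | hk⟩ := Real.sin_eq_sin_iff.1 (Eq.symm ht)
      · exact Or.inl ⟨k, hk.symm⟩
      · exact Or.inr ⟨k, hk.symm⟩
    exact ((Set.countable_range _).union (Set.countable_range _)).mono this
  · push Not at hc
    simp [hc]

/-- The geometric sum is bounded by `2 / ‖z - 1‖` for all `n`. -/
theorem tendsto_geom_mean {z : ℂ} (hz : ‖z‖ = 1) (hz1 : z ≠ 1) :
    Tendsto (fun n : ℕ => (∑ m ∈ Finset.range n, z ^ m) / n) atTop (𝓝 0) := by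
  rw [tendsto_zero_iff_norm_tendsto_zero]
  have h0 : Tendsto (fun n : ℕ => (2 / ‖z - 1‖) / (n : ℝ)) atTop (𝓝 0) :=
    tendsto_const_div_atTop_nhds_zero_nat _
  refine squeeze_zero (fun _ => norm_nonneg _) (fun n => ?_) h0
  rw [norm_div, Complex.norm_natCast, geom_sum_eq hz1, norm_div]
  gcongr
  calc ‖z ^ n - 1‖ ≤ ‖z ^ n‖ + ‖(1 : ℂ)‖ := norm_sub_le _ _
    _ = 2 := by rw [norm_pow, hz]; norm_num

theorem norm_geom_mean_le {z : ℂ} (hz : ‖z‖ = 1) (n : ℕ) :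
    ‖(∑ m ∈ Finset.range n, z ^ m) / n‖ ≤ 1 := by
  rw [norm_div, Complex.norm_natCast]
  refine div_le_one_of_le₀ ((norm_sum_le _ _).trans ?_) (by positivity)
  simp [hz]

/-- A form of Wiener's lemma for the push-forward under `D sin` of Lebesgue measure on an
interval. -/
theorem tendsto_mean_sq_integral_exp_sin {D : ℝ} (hD : 0 < D) (a b : ℝ) (hab : a ≤ b) :
    Tendsto (fun n : ℕ => (1 / (n : ℝ) ^ 2) * ∑ m : Fin n, ∑ k : Fin n,
      ‖∫ t in a..b, Complex.exp (-(2 * Real.pi * Complex.I * D *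
        (((m : ℕ) : ℂ) - ((k : ℕ) : ℂ)) * Real.sin t))‖ ^ 2) atTop (𝓝 0) := by
  set ν := (volume.restrict (Set.Ioc a b)) with hν
  -- Expanding the squared modulus of the mean of `z ^ m` and integrating over two copies of the
  -- interval turns the term `(m, k)` into the squared modulus of the integral in the statement. Off
  -- the null set `z = 1` the means tend to `0`, and they are bounded by `1`.
  let z : ℝ × ℝ → ℂ := fun p =>
    Complex.exp ((2 * Real.pi * D * (Real.sin p.2 - Real.sin p.1) : ℝ) * Complex.I)
  have hz (p) : ‖z p‖ = 1 := Complex.norm_exp_ofReal_mul_I _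
  have hzc : Continuous z := by fun_prop
  let G : ℕ → ℝ × ℝ → ℝ := fun n p => ‖(∑ m ∈ Finset.range n, z p ^ m) / n‖ ^ 2
  have hae : ∀ᵐ p ∂(ν.prod ν), z p ≠ 1 := by
    have hms : MeasurableSet {p | z p ≠ 1} :=
      (measurableSet_eq_fun hzc.measurable measurable_const).compl
    rw [Measure.ae_prod_iff_ae_ae hms]
    refine ae_of_all _ fun x => ?_
    have hc : {y : ℝ | z (x, y) = 1}.Countable := by
      -- This is where `D ≠ 0` matters: `z = 1` says that `D (sin y - sin x)` is an integer, which
      -- leaves countably many `y` for each `x`.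
      have : {y : ℝ | z (x, y) = 1} ⊆ ⋃ k : ℤ, {y | Real.sin y = Real.sin x + k / D} := by
        intro y hy
        obtain ⟨k, hk⟩ := Complex.exp_eq_one_iff.1 hy
        refine Set.mem_iUnion.2 ⟨k, ?_⟩
        have h1 : ((2 * Real.pi * D * (Real.sin y - Real.sin x) : ℝ) : ℂ) =
            ((k * (2 * Real.pi) : ℝ) : ℂ) := by
          refine mul_right_cancel₀ Complex.I_ne_zero (hk.trans ?_)
          push_cast
          ring
        have h2 := Complex.ofReal_injective h1
        have h3 : D * (Real.sin y - Real.sin x) = k := by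
          have := Real.pi_pos
          refine mul_left_cancel₀ (show (2 * Real.pi) ≠ 0 by positivity) ?_
          linarith
        simp only [Set.mem_ofPred_eq]
        field_simp
        linarith
      exact (Set.countable_iUnion fun k => countable_setOf_sin_eq _).mono this
    have : ν {y : ℝ | z (x, y) = 1} = 0 := hc.measure_zero _
    simpa [ae_iff] using this
  have hlim : Tendsto (fun n => ∫ p, G n p ∂(ν.prod ν)) atTop (𝓝 (∫ _, 0 ∂(ν.prod ν))) := by
    refine tendsto_integral_of_dominated_convergence (fun _ => 1) (fun n => ?_)
      (integrable_const _) (fun n => ae_of_all _ fun p => ?_) ?_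
    · exact Continuous.aestronglyMeasurable (by fun_prop)
    · simp only [G, norm_pow, norm_norm]
      exact pow_le_one₀ (norm_nonneg _) (norm_geom_mean_le (hz p) n)
    · filter_upwards [hae] with p hp
      simpa only [norm_zero, zero_pow two_ne_zero] using
        (tendsto_geom_mean (hz p) hp).norm.pow 2
  rw [integral_zero] at hlim
  refine hlim.congr fun n => ?_
  have hG (p : ℝ × ℝ) : ((G n p : ℝ) : ℂ) = ∑ m : Fin n, ∑ k : Fin n, (1 / (n : ℂ) ^ 2) *
      (Complex.exp (-(2 * Real.pi * Complex.I * D *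
        (((m : ℕ) : ℂ) - ((k : ℕ) : ℂ)) * Real.sin p.1)) *
      star (Complex.exp (-(2 * Real.pi * Complex.I * D *
        (((m : ℕ) : ℂ) - ((k : ℕ) : ℂ)) * Real.sin p.2)))) := by
    have h1 : ((G n p : ℝ) : ℂ) = ((∑ m : Fin n, z p ^ (m : ℕ)) / n) *
        star ((∑ m : Fin n, z p ^ (m : ℕ)) / n) := by
      rw [RCLike.star_def, Complex.mul_conj, Complex.normSq_eq_norm_sq,
        Fin.sum_univ_eq_sum_range (fun m => z p ^ m)]
    rw [h1, star_div₀, div_mul_div_comm, star_sum, Finset.sum_mul_sum, Finset.sum_div]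
    refine Finset.sum_congr rfl fun m _ => ?_
    rw [Finset.sum_div]
    refine Finset.sum_congr rfl fun k _ => ?_
    simp only [RCLike.star_def, map_natCast]
    rw [div_eq_mul_one_div, mul_comm, sq]
    congr 1
    simp only [z, ← Complex.exp_conj, ← Complex.exp_nat_mul]
    rw [← Complex.exp_add, ← Complex.exp_add]
    congr 1
    simp only [map_neg, map_mul, Complex.conj_I, Complex.conj_ofReal, map_sub, map_natCast,
      map_ofNat]
    push_cast
    ring
  have hint (m k : Fin n) (f : ℝ → ℂ)
      (hf : f = fun t => Complex.exp (-(2 * Real.pi * Complex.I * D *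
        (((m : ℕ) : ℂ) - ((k : ℕ) : ℂ)) * Real.sin t))) :
      Integrable (fun p : ℝ × ℝ => f p.1 * star (f p.2)) (ν.prod ν) ∧
      ∫ p, f p.1 * star (f p.2) ∂(ν.prod ν) = ((‖∫ t in a..b, f t‖ ^ 2 : ℝ) : ℂ) := by
    have hfc : Continuous f := by rw [hf]; fun_prop
    have hfi : Integrable f ν := by
      have := hfc.intervalIntegrable (μ := volume) a b
      rwa [intervalIntegrable_iff_integrableOn_Ioc_of_le hab] at this
    have hfs : Integrable (fun t => star (f t)) ν := by
      exact (Complex.conjCLE.toContinuousLinearMap.integrable_comp hfi)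
    refine ⟨hfi.mul_prod hfs, ?_⟩
    rw [integral_prod_mul f (fun t => star (f t)), intervalIntegral.integral_of_le hab, ← hν]
    have : ∫ t, star (f t) ∂ν = star (∫ t, f t ∂ν) := integral_conj
    rw [this, RCLike.star_def, Complex.mul_conj, Complex.normSq_eq_norm_sq]
  have hc : ((∫ p, G n p ∂(ν.prod ν) : ℝ) : ℂ) = (((1 / (n : ℝ) ^ 2) *
      ∑ m : Fin n, ∑ k : Fin n,
      ‖∫ t in a..b, Complex.exp (-(2 * Real.pi * Complex.I * D *
        (((m : ℕ) : ℂ) - ((k : ℕ) : ℂ)) * Real.sin t))‖ ^ 2 : ℝ) : ℂ) := by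
    rw [← integral_complex_ofReal]
    simp_rw [hG]
    rw [integral_finsetSum _ fun m _ => integrable_finsetSum _ fun k _ =>
      ((hint m k _ rfl).1.const_mul _)]
    rw [Complex.ofReal_mul, Complex.ofReal_sum, Finset.mul_sum]
    refine Finset.sum_congr rfl fun m _ => ?_
    rw [integral_finsetSum _ fun k _ => ((hint m k _ rfl).1.const_mul _), Complex.ofReal_sum,
      Finset.mul_sum]
    refine Finset.sum_congr rfl fun k _ => ?_
    rw [integral_const_mul, (hint m k _ rfl).2]
    push_cast
    ring
  exact Complex.ofReal_injective hc

namespace Setup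

variable {N L : ℕ} (S : Setup N L)

theorem tendsto_mean_sq_R (hD : 0 < S.D) (hΔ : 0 < S.Δ) (u : Fin 2) :
    Tendsto (fun n : ℕ => (1 / (n : ℝ) ^ 2) * ∑ m, ∑ k, ‖S.R n u m k‖ ^ 2) atTop (𝓝 0) := by
  have h := (tendsto_mean_sq_integral_exp_sin hD (S.θ u - S.Δ) (S.θ u + S.Δ)
    (by linarith)).const_mul (‖(1 / (2 * S.Δ * L) : ℂ)‖ ^ 2)
  rw [mul_zero] at h
  refine h.congr fun n => ?_
  rw [mul_left_comm, Finset.mul_sum]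
  congr 1
  refine Finset.sum_congr rfl fun m _ => ?_
  rw [Finset.mul_sum]
  refine Finset.sum_congr rfl fun k _ => ?_
  rw [← mul_pow, ← norm_mul]
  rfl

end Setup

end PilotTraining

/-! ### Laplace transform of the squared norm of a Gaussian vector. -/

namespace PilotTraining

section Laplace

variable {Ω : Type*} [MeasurableSpace Ω] {μ : Measure Ω} {ι : Type*} [Fintype ι]

theorem HasLaw.integral_exp_re_mul_I {X : Ω → ℂ} {v : ℝ≥0}
    (h : HasLaw X (complexGaussian v) μ) :
    ∫ ω, Complex.exp (((X ω).re : ℂ) * Complex.I) ∂μ = Complex.exp (-(v / 4 : ℝ)) := by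
  have h1 := charFun_complexGaussian v 1
  rw [charFun_apply, ← h.map_eq, integral_map h.aemeasurable
    (Continuous.aestronglyMeasurable (by fun_prop))] at h1
  simpa [Complex.inner] using h1

theorem sum_sum_add_smul_one [DecidableEq ι] (Γ : Matrix ι ι ℂ) (s : ℝ) (a : ι → ℂ) :
    ∑ i, ∑ j, a i * (Γ + (s : ℂ) • 1) i j * star (a j) =
      ∑ i, ∑ j, a i * Γ i j * star (a j) + (s * ∑ i, ‖a i‖ ^ 2 : ℝ) := by
  simp only [Matrix.add_apply, Matrix.smul_apply, mul_add, add_mul, Finset.sum_add_distrib,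
    Matrix.one_apply]
  congr 1
  simp only [smul_eq_mul, mul_ite, mul_one, mul_zero, ite_mul, zero_mul, Finset.sum_ite_eq,
    Finset.mem_univ, if_true]
  push_cast
  rw [Finset.mul_sum]
  refine Finset.sum_congr rfl fun i _ => ?_
  rw [← Complex.ofReal_pow, ← Complex.normSq_eq_norm_sq, ← Complex.mul_conj]
  simp only [RCLike.star_def]
  ring

/-- A bound for the Laplace transform of the squared norm of a circular Gaussian vector whose
covariance dominates `s • 1`. -/
theorem IsCircularGaussian.integral_exp_neg_le [DecidableEq ι] [IsProbabilityMeasure μ]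
    {f g : ι → Ω → ℂ} {Γ : Matrix ι ι ℂ} {s l : ℝ} (hs : 0 ≤ s) (hl : 0 < l)
    (hg : IsCircularGaussian μ g Γ) (hf : IsCircularGaussian μ f (Γ + (s : ℂ) • 1)) :
    ∫ ω, Real.exp (-(l * ∑ i, ‖f i ω‖ ^ 2)) ∂μ ≤ ((1 + l * s) ^ Fintype.card ι)⁻¹ := by
  set n := Fintype.card ι
  -- With this `b`, `exp (-l |U|²)` is up to a constant the Fourier integral of `exp (-b |v|²)` over
  -- `v` in real dimension `2 n`. After Fubini the expectation falls on `exp (i U·v)`, whose mean is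
  -- at most `exp (-(s / 4) |v|²)` in modulus. The remaining Gaussian integral contributes `(b / (b
  -- + s / 4)) ^ n = (1 + l s) ^ (-n)`.
  set b : ℝ := 1 / (4 * l) with hb
  have hb0 : 0 < b := by positivity
  let U : ι ⊕ ι → Ω → ℝ := Sum.elim (fun i ω => (f i ω).re) (fun i ω => (f i ω).im)
  have hUm (k) : AEMeasurable (U k) μ := by
    rcases k with i | i
    · exact Complex.measurable_re.comp_aemeasurable (hf.aemeasurable i)
    · exact Complex.measurable_im.comp_aemeasurable (hf.aemeasurable i)
  have hUsq (ω : Ω) : ∑ k, U k ω ^ 2 = ∑ i, ‖f i ω‖ ^ 2 := by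
    rw [Fintype.sum_sum_type, ← Finset.sum_add_distrib]
    refine Finset.sum_congr rfl fun i _ => ?_
    rw [← Complex.normSq_eq_norm_sq, Complex.normSq_apply]
    simp only [U, Sum.elim_inl, Sum.elim_inr]
    ring
  have hchar (v : ι ⊕ ι → ℝ) : ‖∫ ω, Complex.exp (∑ k, Complex.I * U k ω * v k) ∂μ‖ ≤
      Real.exp (-(s / 4) * ∑ k, v k ^ 2) := by
    let a : ι → ℂ := fun i => (v (Sum.inl i) : ℂ) - v (Sum.inr i) * Complex.I
    obtain ⟨V, hV, hX⟩ := hf a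
    -- The vector `g` serves only to show that the quadratic form of `Γ` is nonnegative.
    obtain ⟨V', hV', -⟩ := hg a
    have hn (i : ι) : ‖a i‖ ^ 2 = v (Sum.inl i) ^ 2 + v (Sum.inr i) ^ 2 := by
      rw [← Complex.normSq_eq_norm_sq, Complex.normSq_apply]
      simp [a]
      ring
    have hVV : (V : ℝ) = V' + s * ∑ k, v k ^ 2 := by
      rw [sum_sum_add_smul_one, ← hV', ← Complex.ofReal_add] at hV
      rw [Complex.ofReal_injective hV, Fintype.sum_sum_type, ← Finset.sum_add_distrib]
      simp only [hn]
    have he (ω : Ω) : ∑ k, Complex.I * U k ω * v k =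
        ((∑ i, a i * f i ω).re : ℂ) * Complex.I := by
      rw [Fintype.sum_sum_type, ← Finset.sum_add_distrib, Complex.re_sum, Complex.ofReal_sum,
        Finset.sum_mul]
      refine Finset.sum_congr rfl fun i _ => ?_
      simp [U, a]
      ring
    simp_rw [he]
    rw [HasLaw.integral_exp_re_mul_I hX, ← Complex.ofReal_neg, Complex.norm_exp_ofReal,
      Real.exp_le_exp, hVV]
    have : (0 : ℝ) ≤ V' := V'.2
    linarith
  have hcard : ((Fintype.card (ι ⊕ ι) : ℕ) : ℂ) / 2 = (n : ℕ) := by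
    rw [Fintype.card_sum]
    push_cast
    simp [n]
  have hpt (ω : Ω) : (((Real.pi / b) ^ n * Real.exp (-(l * ∑ i, ‖f i ω‖ ^ 2)) : ℝ) : ℂ) =
      ∫ v : ι ⊕ ι → ℝ, Complex.exp (-b * ∑ k, (v k : ℂ) ^ 2 + ∑ k, Complex.I * U k ω * v k) := by
    rw [GaussianFourier.integral_cexp_neg_mul_sum_add (by simpa using hb0), hcard,
      Complex.cpow_natCast, ← hUsq]
    push_cast
    congr 2
    simp only [mul_pow, Complex.I_sq, hb]
    push_cast
    have : (l : ℂ) ≠ 0 := by exact_mod_cast hl.ne'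
    rw [← Finset.mul_sum]
    field_simp
  have hgi (c : ℝ) (hc : 0 < c) : Integrable (fun v : ι ⊕ ι → ℝ =>
      Real.exp (-c * ∑ k, v k ^ 2)) := by
    have := (GaussianFourier.integrable_cexp_neg_mul_sum_add (b := c) (by simpa using hc)
      (fun _ : ι ⊕ ι => 0)).norm
    refine this.congr (ae_of_all _ fun v => ?_)
    simp only [zero_mul, Finset.sum_const_zero, add_zero]
    rw [← Complex.norm_exp_ofReal]
    push_cast
    rfl
  have hgv (c : ℝ) (hc : 0 < c) : ∫ v : ι ⊕ ι → ℝ, Real.exp (-c * ∑ k, v k ^ 2) =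
      (Real.pi / c) ^ n := by
    have := GaussianFourier.integral_cexp_neg_mul_sum_add (b := c) (by simpa using hc)
      (fun _ : ι ⊕ ι => 0)
    rw [hcard, Complex.cpow_natCast] at this
    simp only [zero_mul, Finset.sum_const_zero, add_zero, zero_pow two_ne_zero, zero_div,
      Complex.exp_zero, mul_one] at this
    apply Complex.ofReal_injective
    rw [← integral_complex_ofReal]
    push_cast
    exact this
  have hFi : Integrable (fun p : Ω × (ι ⊕ ι → ℝ) =>
      Complex.exp (-b * ∑ k, (p.2 k : ℂ) ^ 2 + ∑ k, Complex.I * U k p.1 * p.2 k))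
      (μ.prod volume) := by
    have h1 : Integrable (fun p : Ω × (ι ⊕ ι → ℝ) => (1 : ℝ) * Real.exp (-b * ∑ k, p.2 k ^ 2))
      (μ.prod volume) := (integrable_const (1 : ℝ)).mul_prod (hgi b hb0)
    refine h1.mono' ?_ (ae_of_all _ fun p => ?_)
    · have hU' (k) : AEMeasurable (fun p : Ω × (ι ⊕ ι → ℝ) => U k p.1) (μ.prod volume) :=
        (hUm k).comp_fst
      exact AEMeasurable.aestronglyMeasurable (by fun_prop)
    · rw [Complex.norm_exp, one_mul]
      apply le_of_eq
      congr 1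
      simp only [Complex.add_re, Complex.re_sum]
      have : ∀ k, (Complex.I * U k p.1 * p.2 k).re = 0 := fun k => by simp
      simp only [this, Finset.sum_const_zero, add_zero]
      rw [← Complex.ofReal_re (-b * ∑ k, p.2 k ^ 2)]
      push_cast
      rfl
  have hmain : (Real.pi / b) ^ n * ∫ ω, Real.exp (-(l * ∑ i, ‖f i ω‖ ^ 2)) ∂μ ≤
      (Real.pi / (b + s / 4)) ^ n := by
    have h1 : (((Real.pi / b) ^ n * ∫ ω, Real.exp (-(l * ∑ i, ‖f i ω‖ ^ 2)) ∂μ : ℝ) : ℂ) =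
        ∫ v : ι ⊕ ι → ℝ, ∫ ω, Complex.exp (-b * ∑ k, (v k : ℂ) ^ 2 +
          ∑ k, Complex.I * U k ω * v k) ∂μ := by
      rw [← integral_const_mul, ← integral_complex_ofReal]
      simp_rw [hpt]
      exact integral_integral_swap hFi
    have h2 : (0 : ℝ) ≤ (Real.pi / b) ^ n * ∫ ω, Real.exp (-(l * ∑ i, ‖f i ω‖ ^ 2)) ∂μ :=
      mul_nonneg (by positivity) (integral_nonneg fun _ => (Real.exp_pos _).le)
    rw [← abs_of_nonneg h2, ← Real.norm_eq_abs, ← Complex.norm_real, h1,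
      ← hgv (b + s / 4) (by positivity)]
    refine norm_integral_le_of_norm_le (hgi _ (by positivity)) (ae_of_all _ fun v => ?_)
    simp_rw [Complex.exp_add]
    rw [integral_const_mul, norm_mul, neg_add, add_mul, Real.exp_add]
    gcongr
    · apply le_of_eq
      rw [← Complex.norm_exp_ofReal]
      push_cast
      rfl
    · exact hchar v
  have h3 : (Real.pi / (b + s / 4)) ^ n = (Real.pi / b) ^ n * ((1 + l * s) ^ n)⁻¹ := by
    rw [← inv_pow, ← mul_pow]
    congr 1
    have : 0 < 1 + l * s := by positivity
    rw [hb]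
    field_simp
  rw [h3] at hmain
  exact le_of_mul_le_mul_left hmain (by positivity)

end Laplace

end PilotTraining

/-! ### Uniform second moment of the inverse determinant. -/

namespace PilotTraining

open scoped ENNReal

theorem lintegral_exp_neg_mul_norm_sq {c : ℝ} (hc : 0 < c) :
    ∫⁻ z : ℂ, ENNReal.ofReal (Real.exp (-(c * ‖z‖ ^ 2))) = ENNReal.ofReal (Real.pi / c) := by
  have h1 : Integrable (fun z : ℂ => Real.exp (-(c * ‖z‖ ^ 2))) := by
    have := (GaussianFourier.integrable_cexp_neg_mul_sq_norm_add (V := ℂ) (b := c)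
      (by simpa using hc) 0 0).norm
    refine this.congr (ae_of_all _ fun z => ?_)
    simp only [zero_mul, add_zero]
    rw [← Complex.norm_exp_ofReal]
    push_cast
    simp
  rw [← ofReal_integral_eq_lintegral_ofReal h1 (ae_of_all _ fun _ => (Real.exp_pos _).le)]
  have h2 := GaussianFourier.integral_rexp_neg_mul_sq_norm (V := ℂ) hc
  simp only [Complex.finrank_real_complex, neg_mul] at h2
  rw [h2]
  norm_num

theorem lintegral_exp_neg_quadratic {a d : ℝ} {b : ℂ} (ha : 0 < a) (hD : 0 < a * d - ‖b‖ ^ 2) :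
    ∫⁻ p : ℂ × ℂ, ENNReal.ofReal (Real.exp (-(a * ‖p.1‖ ^ 2 + d * ‖p.2‖ ^ 2 +
      2 * (p.1 * star p.2 * b).re))) = ENNReal.ofReal (Real.pi ^ 2 / (a * d - ‖b‖ ^ 2)) := by
  -- Completing the square in `x`: the shift by a multiple of `y` disappears by translation
  -- invariance, and each of the two complex Gaussian integrals gives `π / c`.
  have hsq (x y : ℂ) : a * ‖x‖ ^ 2 + d * ‖y‖ ^ 2 + 2 * (x * star y * b).re =
      a * ‖x + y * star b / a‖ ^ 2 + (a * d - ‖b‖ ^ 2) / a * ‖y‖ ^ 2 := by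
    have : y * star b / a = ((1 / a : ℝ) : ℂ) * (y * star b) := by push_cast; ring
    rw [this]
    simp only [← Complex.normSq_eq_norm_sq, Complex.normSq_apply, Complex.add_re, Complex.add_im,
      Complex.mul_re, Complex.mul_im, Complex.ofReal_re, Complex.ofReal_im, RCLike.star_def,
      Complex.conj_re, Complex.conj_im]
    field_simp
    ring
  rw [Measure.volume_eq_prod, lintegral_prod_symm' _ (by fun_prop)]
  simp only [hsq]
  have hin (y : ℂ) : ∫⁻ x : ℂ, ENNReal.ofReal (Real.exp (-(a * ‖x + y * star b / a‖ ^ 2 +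
      (a * d - ‖b‖ ^ 2) / a * ‖y‖ ^ 2))) = ENNReal.ofReal (Real.pi / a) *
      ENNReal.ofReal (Real.exp (-((a * d - ‖b‖ ^ 2) / a * ‖y‖ ^ 2))) := by
    simp only [neg_add, Real.exp_add, ENNReal.ofReal_mul (Real.exp_pos _).le]
    rw [lintegral_mul_const _ (by fun_prop), lintegral_add_right_eq_self
      (fun x : ℂ => ENNReal.ofReal (Real.exp (-(a * ‖x‖ ^ 2)))), lintegral_exp_neg_mul_norm_sq ha]
  simp only [hin]
  rw [lintegral_const_mul _ (by fun_prop), lintegral_exp_neg_mul_norm_sq (by positivity),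
    ← ENNReal.ofReal_mul (by positivity)]
  congr 1
  field_simp

section Gram

variable {ι : Type*} [Fintype ι]

theorem sum_norm_sq_comb (y : Matrix (Fin 2) ι ℂ) (p q : ℂ) :
    ∑ x, ‖p * y 0 x + q * y 1 x‖ ^ 2 = (∑ x, ‖y 0 x‖ ^ 2) * ‖p‖ ^ 2 +
      (∑ x, ‖y 1 x‖ ^ 2) * ‖q‖ ^ 2 + 2 * (p * star q * ∑ x, y 0 x * star (y 1 x)).re := by
  rw [Finset.mul_sum, Complex.re_sum, Finset.sum_mul, Finset.sum_mul, Finset.mul_sum,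
    ← Finset.sum_add_distrib, ← Finset.sum_add_distrib]
  refine Finset.sum_congr rfl fun x _ => ?_
  simp only [← Complex.normSq_eq_norm_sq, Complex.normSq_apply, Complex.add_re, Complex.add_im,
    Complex.mul_re, Complex.mul_im, RCLike.star_def, Complex.conj_re, Complex.conj_im]
  ring

theorem det_smul_gram (y : Matrix (Fin 2) ι ℂ) (r : ℝ) :
    ((r : ℂ) • (y * yᴴ)).det = (((r * ∑ x, ‖y 0 x‖ ^ 2) * (r * ∑ x, ‖y 1 x‖ ^ 2) -
      ‖(r : ℂ) * ∑ x, y 0 x * star (y 1 x)‖ ^ 2 : ℝ) : ℂ) := by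
  have h (z : ℂ) : z * star z = ((‖z‖ ^ 2 : ℝ) : ℂ) := by
    rw [RCLike.star_def, Complex.mul_conj, Complex.normSq_eq_norm_sq]
  have hs : star (∑ x, y 0 x * star (y 1 x)) = ∑ x, y 1 x * star (y 0 x) := by
    simp [star_sum, mul_comm]
  rw [Matrix.det_fin_two]
  simp only [Matrix.smul_apply, Matrix.mul_apply, Matrix.conjTranspose_apply, smul_eq_mul, h,
    Complex.ofReal_sub, Complex.ofReal_mul, Complex.ofReal_sum]
  rw [← Complex.ofReal_sum, ← Complex.ofReal_sum, ← h, star_mul', hs]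
  simp

open scoped ComplexOrder in
theorem det_smul_gram_nonneg (y : Matrix (Fin 2) ι ℂ) {r : ℝ} (hr : 0 ≤ r) :
    0 ≤ (r * ∑ x, ‖y 0 x‖ ^ 2) * (r * ∑ x, ‖y 1 x‖ ^ 2) -
      ‖(r : ℂ) * ∑ x, y 0 x * star (y 1 x)‖ ^ 2 := by
  have h1 := (Matrix.posSemidef_self_mul_conjTranspose y).smul
    (show (0 : ℂ) ≤ (r : ℂ) by simpa using hr) |>.det_nonneg
  rw [det_smul_gram] at h1
  exact_mod_cast h1

/-- The Gaussian integral of a positive definite Hermitian form on `ℂ²` is `π² / det`, so this is an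
equality when the determinant is nonzero. A singular matrix has inverse determinant `0` by
convention, hence only an inequality. The right side has the merit that its expectation is governed
by Laplace transforms. -/
theorem inv_norm_det_le (y : Matrix (Fin 2) ι ℂ) {r : ℝ} (hr : 0 ≤ r) :
    ENNReal.ofReal ‖((r : ℂ) • (y * yᴴ)).det‖⁻¹ ≤ ENNReal.ofReal (1 / Real.pi ^ 2) *
      ∫⁻ p : ℂ × ℂ, ENNReal.ofReal
        (Real.exp (-(r * ∑ x, ‖p.1 * y 0 x + p.2 * y 1 x‖ ^ 2))) := by
  set a := r * ∑ x, ‖y 0 x‖ ^ 2 with ha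
  set d := r * ∑ x, ‖y 1 x‖ ^ 2 with hd
  set b := (r : ℂ) * ∑ x, y 0 x * star (y 1 x) with hb
  have h0 : 0 ≤ a * d - ‖b‖ ^ 2 := det_smul_gram_nonneg y hr
  rw [det_smul_gram, Complex.norm_real, Real.norm_of_nonneg (det_smul_gram_nonneg y hr),
    ← ha, ← hd, ← hb]
  have ha_nonneg : 0 ≤ a := by positivity
  clear_value a d b
  rcases h0.eq_or_lt with h | h
  · rw [← h]
    simp
  have ha0 : 0 < a := by
    refine ha_nonneg.lt_of_ne fun h' => ?_
    rw [← h', zero_mul] at h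
    linarith [sq_nonneg ‖b‖]
  have hq (p : ℂ × ℂ) : r * ∑ x, ‖p.1 * y 0 x + p.2 * y 1 x‖ ^ 2 =
      a * ‖p.1‖ ^ 2 + d * ‖p.2‖ ^ 2 + 2 * (p.1 * star p.2 * b).re := by
    rw [sum_norm_sq_comb, ha, hd, hb, mul_left_comm _ (r : ℂ), Complex.re_ofReal_mul]
    ring
  simp only [hq]
  rw [lintegral_exp_neg_quadratic ha0 h, ← ENNReal.ofReal_mul (by positivity)]
  apply le_of_eq
  congr 1
  have := Real.pi_pos
  field_simp

end Gram

/-- Cauchy–Schwarz for `f = W^(-1/2) · (W^(1/2) f)`. -/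
theorem sq_lintegral_le_weighted {f W : ℂ × ℂ → ℝ} (hf : Measurable f) (hf0 : ∀ z, 0 ≤ f z)
    (hW : Measurable W) (hW0 : ∀ z, 0 < W z) :
    (∫⁻ z, ENNReal.ofReal (f z)) ^ 2 ≤
      (∫⁻ z, ENNReal.ofReal (W z)⁻¹) * ∫⁻ z, ENNReal.ofReal (W z * f z ^ 2) := by
  have h := ENNReal.lintegral_mul_le_Lp_mul_Lq (volume : Measure (ℂ × ℂ)) Real.HolderConjugate.two_two
    (f := fun z => ENNReal.ofReal (Real.sqrt (W z)⁻¹))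
    (g := fun z => ENNReal.ofReal (Real.sqrt (W z) * f z)) (by fun_prop) (by fun_prop)
  have e (z) : ((fun z => ENNReal.ofReal (Real.sqrt (W z)⁻¹)) *
      fun z => ENNReal.ofReal (Real.sqrt (W z) * f z)) z = ENNReal.ofReal (f z) := by
    rw [Pi.mul_apply, ← ENNReal.ofReal_mul (Real.sqrt_nonneg _), ← mul_assoc,
      ← Real.sqrt_mul (inv_nonneg.2 (hW0 z).le), inv_mul_cancel₀ (hW0 z).ne', Real.sqrt_one,
      one_mul]
  have e1 (z) : ENNReal.ofReal (Real.sqrt (W z)⁻¹) ^ (2 : ℝ) = ENNReal.ofReal (W z)⁻¹ := by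
    rw [ENNReal.rpow_two, ← ENNReal.ofReal_pow (Real.sqrt_nonneg _),
      Real.sq_sqrt (inv_nonneg.2 (hW0 z).le)]
  have e2 (z) : ENNReal.ofReal (Real.sqrt (W z) * f z) ^ (2 : ℝ) =
      ENNReal.ofReal (W z * f z ^ 2) := by
    rw [ENNReal.rpow_two, ← ENNReal.ofReal_pow (mul_nonneg (Real.sqrt_nonneg _) (hf0 z)), mul_pow,
      Real.sq_sqrt (hW0 z).le]
  simp only [e, e1, e2] at h
  calc (∫⁻ z, ENNReal.ofReal (f z)) ^ 2 ≤ _ := pow_le_pow_left' h 2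
    _ = _ := by
      rw [mul_pow, ← ENNReal.rpow_two, ← ENNReal.rpow_two, ← ENNReal.rpow_mul, ← ENNReal.rpow_mul]
      norm_num

/-- Bernoulli's inequality with exponent `n / 10 ≥ 1` bounds the `n`-th power below by the tenth
power of `1 + (s / 5) x²`, free of `n`. Ten is twice the exponent of the weight `(1 + ‖z‖) ^ 5` used
below: one factor cancels the weight, the other keeps the integral finite. -/
theorem one_add_mul_sq_pow_ge {s x : ℝ} (hs : 0 < s) (hx : 0 ≤ x) {n : ℕ} (hn : 10 ≤ n) :
    (1 + x) ^ 10 ≤ (2 * max 1 (5 / s)) ^ 10 * (1 + 2 / n * s * x ^ 2) ^ n := by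
  have hn0 : (0 : ℝ) < n := by exact_mod_cast (by omega : 0 < n)
  have hn10 : (10 : ℝ) ≤ n := by exact_mod_cast hn
  have h1 : 1 + s / 5 * x ^ 2 ≤ (1 + 2 / n * s * x ^ 2) ^ ((n : ℝ) / 10) := by
    have := one_add_mul_self_le_rpow_one_add (s := 2 / n * s * x ^ 2)
      (le_trans (by norm_num) (by positivity : (0 : ℝ) ≤ 2 / n * s * x ^ 2))
      (p := (n : ℝ) / 10) (by rw [le_div_iff₀ (by norm_num)]; linarith)
    refine le_trans (le_of_eq ?_) this
    field_simp
    ring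
  have h2 : (1 + 2 / n * s * x ^ 2) ^ n = ((1 + 2 / n * s * x ^ 2) ^ ((n : ℝ) / 10)) ^ 10 := by
    rw [← Real.rpow_mul_natCast (by positivity), ← Real.rpow_natCast]
    congr 1
    push_cast
    field_simp
  rw [h2, ← mul_pow]
  refine pow_le_pow_left₀ (by positivity) ?_ 10
  have h3 : 1 + x ≤ 2 * (1 + x ^ 2) := by nlinarith [sq_nonneg (x - 1), sq_nonneg x]
  have h4 : 1 + x ^ 2 ≤ max 1 (5 / s) * (1 + s / 5 * x ^ 2) := by
    have h5 : (1 : ℝ) ≤ max 1 (5 / s) := le_max_left _ _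
    have h6 : x ^ 2 ≤ max 1 (5 / s) * (s / 5 * x ^ 2) := by
      calc x ^ 2 = 5 / s * (s / 5 * x ^ 2) := by field_simp
        _ ≤ _ := by gcongr; exact le_max_right _ _
    linarith
  calc 1 + x ≤ 2 * (1 + x ^ 2) := h3
    _ ≤ 2 * (max 1 (5 / s) * (1 + s / 5 * x ^ 2)) := by gcongr
    _ = 2 * max 1 (5 / s) * (1 + s / 5 * x ^ 2) := by ring
    _ ≤ _ := by gcongr

/-- A bound, uniform in the dimension, for the second moment of the inverse determinant of
a random `2 × 2` sample covariance matrix. -/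
theorem exists_lintegral_inv_det_sq_le {s : ℝ} (hs : 0 < s) {Ω : Type*} [MeasurableSpace Ω]
    (μ : Measure Ω) [IsProbabilityMeasure μ] :
    ∃ K : ℝ≥0∞, K ≠ ∞ ∧ ∀ (n : ℕ) (ι : Type) [Fintype ι] (y : Ω → Matrix (Fin 2) ι ℂ), 10 ≤ n →
      (∀ k x, AEMeasurable (fun ω => y ω k x) μ) →
      (∀ p q : ℂ, ∫⁻ ω, ENNReal.ofReal
        (Real.exp (-(2 / n * ∑ x, ‖p * y ω 0 x + q * y ω 1 x‖ ^ 2))) ∂μ ≤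
        ENNReal.ofReal ((1 + 2 / n * s * (‖p‖ ^ 2 + ‖q‖ ^ 2)) ^ n)⁻¹) →
      ∫⁻ ω, ENNReal.ofReal ‖(((1 / n : ℝ) : ℂ) • (y ω * (y ω)ᴴ)).det‖⁻¹ ^ 2 ∂μ ≤ K := by
  set J : ℝ≥0∞ := ∫⁻ z : ℂ × ℂ, ENNReal.ofReal ((1 + ‖z‖) ^ 5)⁻¹ with hJ
  have hJf : J ≠ ∞ := by
    -- The exponent `5` is the least integer above the real dimension `4` of `ℂ × ℂ`.
    have := finite_integral_one_add_norm (E := ℂ × ℂ) (μ := volume.prod volume) (r := 5) (by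
      rw [Module.finrank_prod, Complex.finrank_real_complex]
      norm_num)
    refine ne_of_lt (lt_of_le_of_lt (le_of_eq ?_) this)
    refine lintegral_congr fun z => ?_
    congr 1
    rw [Real.rpow_neg (by positivity)]
    norm_cast
  set c : ℝ := (2 * max 1 (5 / s)) ^ 10
  have hmax : (1 : ℝ) ≤ max 1 (5 / s) := le_max_left _ _
  have hc : 0 < c := by positivity
  refine ⟨ENNReal.ofReal (1 / Real.pi ^ 2) ^ 2 * (J * (ENNReal.ofReal c * J)), ?_, ?_⟩
  · finiteness
  intro n ι _ y hn hy hL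
  have hn0 : (0 : ℝ) < n := by exact_mod_cast (by omega : 0 < n)
  -- Cauchy–Schwarz will square `F`, which accounts for the `2 / n` in the Laplace hypothesis.
  let F : Ω → ℂ × ℂ → ℝ := fun ω z =>
    Real.exp (-(1 / n * ∑ x, ‖z.1 * y ω 0 x + z.2 * y ω 1 x‖ ^ 2))
  have hF2 (ω z) : F ω z ^ 2 =
      Real.exp (-(2 / n * ∑ x, ‖z.1 * y ω 0 x + z.2 * y ω 1 x‖ ^ 2)) := by
    rw [← Real.exp_nat_mul]
    congr 1
    push_cast
    ring
  have h1 (ω : Ω) : ENNReal.ofReal ‖(((1 / n : ℝ) : ℂ) • (y ω * (y ω)ᴴ)).det‖⁻¹ ^ 2 ≤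
      ENNReal.ofReal (1 / Real.pi ^ 2) ^ 2 * (J * ∫⁻ z : ℂ × ℂ, ENNReal.ofReal
        ((1 + ‖z‖) ^ 5 * F ω z ^ 2)) := by
    refine (pow_le_pow_left' (inv_norm_det_le (y ω) (by positivity)) 2).trans ?_
    rw [mul_pow]
    gcongr
    refine sq_lintegral_le_weighted (f := F ω) (W := fun z => (1 + ‖z‖) ^ 5) (by fun_prop)
      (fun z => (Real.exp_pos _).le) (by fun_prop) (fun z => by positivity)
  refine (lintegral_mono h1).trans ?_
  rw [lintegral_const_mul' _ _ (by finiteness), lintegral_const_mul' _ _ hJf]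
  gcongr
  have hm : AEMeasurable (Function.uncurry fun (ω : Ω) (z : ℂ × ℂ) =>
      ENNReal.ofReal ((1 + ‖z‖) ^ 5 * F ω z ^ 2)) (μ.prod volume) := by
    have hy' (k x) : AEMeasurable (fun p : Ω × (ℂ × ℂ) => y p.1 k x) (μ.prod volume) :=
      (hy k x).comp_fst
    simp only [F, Function.uncurry_def]
    fun_prop
  rw [lintegral_lintegral_swap hm, hJ, ← lintegral_const_mul' _ _ (by finiteness)]
  refine lintegral_mono fun z => ?_
  calc ∫⁻ ω, ENNReal.ofReal ((1 + ‖z‖) ^ 5 * F ω z ^ 2) ∂μ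
      = ENNReal.ofReal ((1 + ‖z‖) ^ 5) * ∫⁻ ω, ENNReal.ofReal
        (Real.exp (-(2 / n * ∑ x, ‖z.1 * y ω 0 x + z.2 * y ω 1 x‖ ^ 2))) ∂μ := by
        rw [← lintegral_const_mul' _ _ (by finiteness)]
        refine lintegral_congr fun ω => ?_
        rw [hF2, ENNReal.ofReal_mul (by positivity)]
    _ ≤ ENNReal.ofReal ((1 + ‖z‖) ^ 5) *
        ENNReal.ofReal ((1 + 2 / n * s * (‖z.1‖ ^ 2 + ‖z.2‖ ^ 2)) ^ n)⁻¹ := by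
        gcongr
        exact hL z.1 z.2
    _ ≤ ENNReal.ofReal c * ENNReal.ofReal ((1 + ‖z‖) ^ 5)⁻¹ := by
        rw [← ENNReal.ofReal_mul (by positivity), ← ENNReal.ofReal_mul hc.le]
        apply ENNReal.ofReal_le_ofReal
        have hz : ‖z‖ ^ 2 ≤ ‖z.1‖ ^ 2 + ‖z.2‖ ^ 2 := by
          rw [Prod.norm_def]
          rcases max_choice ‖z.1‖ ‖z.2‖ with h | h <;> rw [h] <;> nlinarith [norm_nonneg z.1,
            norm_nonneg z.2]
        have hb := one_add_mul_sq_pow_ge hs (norm_nonneg z) hn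
        have hb' : (1 + ‖z‖) ^ 10 ≤ c * (1 + 2 / n * s * (‖z.1‖ ^ 2 + ‖z.2‖ ^ 2)) ^ n := by
          refine hb.trans ?_
          gcongr
        have hp : 0 < (1 + 2 / n * s * (‖z.1‖ ^ 2 + ‖z.2‖ ^ 2)) ^ n := by positivity
        rw [← div_eq_mul_inv, ← div_eq_mul_inv, div_le_div_iff₀ hp (by positivity)]
        calc (1 + ‖z‖) ^ 5 * (1 + ‖z‖) ^ 5 = (1 + ‖z‖) ^ 10 := by ring
          _ ≤ _ := hb'

end PilotTraining

/-! ### Mean-square convergence and convergence of expectations. -/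

namespace PilotTraining

open scoped ENNReal

section LTwo

variable {Ω : Type*} [MeasurableSpace Ω] {μ : Measure Ω} {E : Type*} [NormedAddCommGroup E]

/-- The random variables `f n` converge to the constant `c` in mean square. -/
def TendstoLTwo (μ : Measure Ω) (f : ℕ → Ω → E) (c : E) : Prop :=
  (∀ n, AEStronglyMeasurable (f n) μ) ∧
    Tendsto (fun n => eLpNorm (fun ω => f n ω - c) 2 μ) atTop (𝓝 0)

theorem TendstoLTwo.of_le {f : ℕ → Ω → E} {c : E} {g : ℕ → ℝ≥0∞}
    (hm : ∀ n, AEStronglyMeasurable (f n) μ)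
    (hle : ∀ n, eLpNorm (fun ω => f n ω - c) 2 μ ≤ g n) (hg : Tendsto g atTop (𝓝 0)) :
    TendstoLTwo μ f c :=
  ⟨hm, tendsto_of_tendsto_of_tendsto_of_le_of_le tendsto_const_nhds hg (fun _ => zero_le) hle⟩

theorem TendstoLTwo.add {f g : ℕ → Ω → E} {c d : E} (hf : TendstoLTwo μ f c)
    (hg : TendstoLTwo μ g d) : TendstoLTwo μ (fun n ω => f n ω + g n ω) (c + d) := by
  refine .of_le (fun n => (hf.1 n).add (hg.1 n)) (fun n => ?_)
    (by simpa using hf.2.add hg.2)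
  have : (fun ω => f n ω + g n ω - (c + d)) = (fun ω => f n ω - c) + fun ω => g n ω - d := by
    funext ω
    simp only [Pi.add_apply]
    abel
  rw [this]
  exact eLpNorm_add_le ((hf.1 n).sub aestronglyMeasurable_const)
    ((hg.1 n).sub aestronglyMeasurable_const) one_le_two

theorem TendstoLTwo.const_mul {f : ℕ → Ω → ℂ} {c : ℂ} (hf : TendstoLTwo μ f c) (a : ℂ) :
    TendstoLTwo μ (fun n ω => a * f n ω) (a * c) := by
  refine .of_le (fun n => (hf.1 n).const_mul a)
    (g := fun n => ‖a‖ₑ * eLpNorm (fun ω => f n ω - c) 2 μ) (fun n => ?_) ?_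
  · have : (fun ω => a * f n ω - a * c) = a • fun ω => f n ω - c := by
      funext ω
      simp [mul_sub]
    rw [this]
    exact (eLpNorm_const_smul _ _ _ _).le
  · simpa using ENNReal.Tendsto.const_mul hf.2 (Or.inr (enorm_ne_top (x := a)))

theorem TendstoLTwo.norm {f : ℕ → Ω → E} {c : E} (hf : TendstoLTwo μ f c) :
    TendstoLTwo μ (fun n ω => ‖f n ω‖) ‖c‖ :=
  .of_le (fun n => (hf.1 n).norm) (fun n => eLpNorm_mono fun ω => by
    simpa using abs_norm_sub_norm_le (f n ω) c) hf.2

theorem TendstoLTwo.tendstoInMeasure {f : ℕ → Ω → E} {c : E} (hf : TendstoLTwo μ f c) :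
    TendstoInMeasure μ f atTop (fun _ => c) :=
  tendstoInMeasure_of_tendsto_eLpNorm two_ne_zero hf.1 aestronglyMeasurable_const hf.2

/-- The limit is a constant, so continuity at that one point suffices; the error function is not
continuous at singular Gram matrices. -/
theorem tendstoInMeasure_comp_of_continuousAt {J : Type*} [Fintype J] {G : ℕ → Ω → J → ℂ}
    {c : J → ℂ} (hG : ∀ j, TendstoInMeasure μ (fun n ω => G n ω j) atTop (fun _ => c j))
    {F : (J → ℂ) → ℝ} (hF : ContinuousAt F c) :
    TendstoInMeasure μ (fun n ω => F (G n ω)) atTop (fun _ => F c) := by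
  intro ε hε
  obtain ⟨η, hη, hη'⟩ := EMetric.continuousAt_iff.1 hF ε hε
  refine tendsto_of_tendsto_of_tendsto_of_le_of_le tendsto_const_nhds
    (g := fun _ => (0 : ℝ≥0∞))
    (h := fun n => ∑ j, μ {ω | η ≤ edist (G n ω j) (c j)}) ?_ (fun _ => zero_le) (fun n => ?_)
  · simpa using tendsto_finsetSum Finset.univ fun j _ => hG j η hη
  · refine (measure_mono (t := ⋃ j ∈ Finset.univ, {ω | η ≤ edist (G n ω j) (c j)}) ?_).trans
      (measure_biUnion_finset_le _ _)
    intro ω hω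
    by_contra h
    have h' : ∀ j, edist (G n ω j) (c j) < η := by simpa using h
    refine absurd (hη' (x := G n ω) ?_) (not_lt.2 hω)
    rw [edist_pi_def, Finset.sup_lt_iff (by simpa using hη)]
    exact fun j _ => h' j

theorem lintegral_enorm_mul_le {f g : Ω → ℝ} (hf : AEStronglyMeasurable f μ)
    (hg : AEStronglyMeasurable g μ) :
    ∫⁻ ω, ‖f ω * g ω‖ₑ ∂μ ≤ eLpNorm f 2 μ * eLpNorm g 2 μ := by
  have := eLpNorm_smul_le_mul_eLpNorm (p := 2) (q := 2) (r := 1) hg hf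
  rw [eLpNorm_one_eq_lintegral_enorm] at this
  exact this

/-- Convergence of expectations for nonnegative random variables that are dominated by
`2 A B + 2 Q`, where `A` and `Q` converge in mean square and `B` is bounded in mean square. -/
theorem tendsto_integral_of_le_mul_add [IsProbabilityMeasure μ] {X A B Q : ℕ → Ω → ℝ}
    {x a q : ℝ} {K : ℝ≥0∞} (hX : ∀ n, AEStronglyMeasurable (X n) μ)
    (hB : ∀ n, AEStronglyMeasurable (B n) μ) (hX0 : ∀ᶠ n in atTop, ∀ ω, 0 ≤ X n ω) (hx : 0 ≤ x)
    (hB0 : ∀ n ω, 0 ≤ B n ω) (hK : K ≠ ∞) (hBK : ∀ᶠ n in atTop, eLpNorm (B n) 2 μ ≤ K)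
    (ha : 0 ≤ a) (hq : 0 ≤ q) (hA : TendstoLTwo μ A a) (hQ : TendstoLTwo μ Q q)
    (hle : ∀ᶠ n in atTop, ∀ ω, X n ω ≤ 2 * (A n ω * B n ω) + 2 * Q n ω)
    (hXx : TendstoInMeasure μ X atTop (fun _ => x)) :
    (∀ᶠ n in atTop, Integrable (X n) μ) ∧ Tendsto (fun n => ∫ ω, X n ω ∂μ) atTop (𝓝 x) := by
  -- Where `X` is within `δ` of `x` the integrand is below `δ`. On the exceptional set, `|X - x| ≤ 2
  -- A B + 2 Q + x`; replacing `A` and `Q` by `a` and `q` costs mean-square errors, and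
  -- Cauchy–Schwarz pairs `B` with the indicator, giving the square root of the measure of the set.
  have key (δ : ℝ) (hδ : 0 < δ) : ∀ᶠ n in atTop, ∫⁻ ω, ‖X n ω - x‖ₑ ∂μ ≤
      ENNReal.ofReal δ + (ENNReal.ofReal (2 * a) *
        (μ {ω | ENNReal.ofReal δ ≤ edist (X n ω) x} ^ (1 / 2 : ℝ) * K) +
      ENNReal.ofReal (2 * q + x) * μ {ω | ENNReal.ofReal δ ≤ edist (X n ω) x} +
      2 * (eLpNorm (fun ω => A n ω - a) 2 μ * K) +
      2 * eLpNorm (fun ω => Q n ω - q) 2 μ) := by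
    filter_upwards [hX0, hBK, hle] with n h0 hBn hlen
    set S := {ω | ENNReal.ofReal δ ≤ edist (X n ω) x} with hS
    have hSm : NullMeasurableSet S μ := by
      have : AEMeasurable (fun ω => edist (X n ω) x) μ :=
        (hX n).aemeasurable.edist aemeasurable_const
      exact this.nullMeasurable measurableSet_Ici
    -- The measurable hull has the same measure and a measurable indicator.
    let S' := toMeasurable μ S
    have hS' : MeasurableSet S' := measurableSet_toMeasurable μ S
    have hSμ : μ S' = μ S := measure_toMeasurable S
    let I : Ω → ℝ := S'.indicator fun _ => 1
    have hI : AEStronglyMeasurable I μ := (stronglyMeasurable_const.indicator hS').aestronglyMeasurable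
    have hI0 (ω) : 0 ≤ I ω := Set.indicator_nonneg (fun _ _ => zero_le_one) ω
    have hreal (ω : Ω) : |X n ω - x| ≤ δ + (2 * a) * (I ω * B n ω) + (2 * q + x) * I ω +
        2 * (|A n ω - a| * B n ω) + 2 * |Q n ω - q| := by
      have hb := hB0 n ω
      have e1 : 0 ≤ (2 * a) * (I ω * B n ω) :=
        mul_nonneg (by positivity) (mul_nonneg (hI0 ω) hb)
      have e2 : 0 ≤ (2 * q + x) * I ω := mul_nonneg (by positivity) (hI0 ω)
      have e3 : 0 ≤ 2 * (|A n ω - a| * B n ω) := by positivity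
      have e4 : 0 ≤ 2 * |Q n ω - q| := by positivity
      by_cases hω : ω ∈ S
      · have hω' : I ω = 1 := Set.indicator_of_mem (subset_toMeasurable μ S hω) _
        rw [hω']
        have h1 : |X n ω - x| ≤ X n ω + x := by
          rw [abs_le]
          constructor <;> linarith [h0 ω]
        have h2 : A n ω * B n ω ≤ a * B n ω + |A n ω - a| * B n ω := by
          rw [← add_mul]
          exact mul_le_mul_of_nonneg_right (by linarith [le_abs_self (A n ω - a)]) hb
        have h3 := le_abs_self (Q n ω - q)
        linarith [hlen ω]
      · have h1 : |X n ω - x| < δ := by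
          have : edist (X n ω) x < ENNReal.ofReal δ := not_le.1 hω
          rw [edist_dist, ENNReal.ofReal_lt_ofReal_iff hδ, Real.dist_eq] at this
          exact this
        linarith
    have hterm (ω : Ω) : ‖X n ω - x‖ₑ ≤ ENNReal.ofReal δ +
        (ENNReal.ofReal (2 * a) * ‖I ω * B n ω‖ₑ + ENNReal.ofReal (2 * q + x) * ‖I ω‖ₑ +
        2 * ‖(A n ω - a) * B n ω‖ₑ + 2 * ‖Q n ω - q‖ₑ) := by
      have hb := hB0 n ω
      have hi := hI0 ω
      simp only [Real.enorm_eq_ofReal_abs, abs_mul, abs_of_nonneg hb, abs_of_nonneg hi]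
      rw [show (2 : ℝ≥0∞) = ENNReal.ofReal 2 by simp, ← ENNReal.ofReal_mul (by positivity),
        ← ENNReal.ofReal_mul (by positivity), ← ENNReal.ofReal_mul (by positivity),
        ← ENNReal.ofReal_mul (by positivity), ← ENNReal.ofReal_add (by positivity) (by positivity),
        ← ENNReal.ofReal_add (by positivity) (by positivity),
        ← ENNReal.ofReal_add (by positivity) (by positivity),
        ← ENNReal.ofReal_add (by positivity) (by positivity)]
      exact ENNReal.ofReal_le_ofReal (by linarith [hreal ω])
    have mA := (hA.1 n).sub (aestronglyMeasurable_const (b := a))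
    have mQ := (hQ.1 n).sub (aestronglyMeasurable_const (b := q))
    refine (lintegral_mono hterm).trans ?_
    have m1 : AEMeasurable (fun ω => ‖I ω * B n ω‖ₑ) μ := (hI.mul (hB n)).enorm
    have m2 : AEMeasurable (fun ω => ‖I ω‖ₑ) μ := hI.enorm
    have m3 : AEMeasurable (fun ω => ‖(A n ω - a) * B n ω‖ₑ) μ := (mA.mul (hB n)).enorm
    have m4 : AEMeasurable (fun ω => ‖Q n ω - q‖ₑ) μ := mQ.enorm
    rw [lintegral_add_left' aemeasurable_const, lintegral_add_right' _ (m4.const_mul _),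
      lintegral_add_right' _ (m3.const_mul _), lintegral_add_right' _ (m2.const_mul _),
      lintegral_const_mul'' _ m1, lintegral_const_mul'' _ m2, lintegral_const_mul'' _ m3,
      lintegral_const_mul'' _ m4]
    gcongr
    · simp
    · refine (lintegral_enorm_mul_le hI (hB n)).trans ?_
      gcongr
      have := eLpNorm_indicator_const (μ := μ) (p := 2) (c := (1 : ℝ)) hS' (by simp) (by simp)
      simp only [I]
      rw [this, hSμ]
      simp
    · have h := eLpNorm_indicator_const (μ := μ) (p := 1) (c := (1 : ℝ)) hS' (by simp) (by simp)
      rw [eLpNorm_one_eq_lintegral_enorm, hSμ] at h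
      exact (h.trans (by simp)).le
    · refine (lintegral_enorm_mul_le mA (hB n)).trans ?_
      gcongr
      rfl
    · rw [← eLpNorm_one_eq_lintegral_enorm]
      exact eLpNorm_le_eLpNorm_of_exponent_le one_le_two mQ
  have hlim (δ : ℝ) (hδ : 0 < δ) : ∀ᶠ n in atTop, ∫⁻ ω, ‖X n ω - x‖ₑ ∂μ ≤
      ENNReal.ofReal (2 * δ) := by
    have hμ := hXx (ENNReal.ofReal δ) (by simpa using hδ)
    have t1 : Tendsto (fun n => μ {ω | ENNReal.ofReal δ ≤ edist (X n ω) x} ^ (1 / 2 : ℝ) * K)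
        atTop (𝓝 0) := by
      have := ENNReal.Tendsto.mul_const (b := K)
        ((ENNReal.continuous_rpow_const (y := 1 / 2)).tendsto _ |>.comp hμ) (Or.inr hK)
      simpa using this
    have t2 := ENNReal.Tendsto.mul_const (b := K) hA.2 (Or.inr hK)
    rw [zero_mul] at t2
    have t3 := (((ENNReal.Tendsto.const_mul (a := ENNReal.ofReal (2 * a)) t1
      (Or.inr ENNReal.ofReal_ne_top)).add
      (ENNReal.Tendsto.const_mul (a := ENNReal.ofReal (2 * q + x)) hμ
      (Or.inr ENNReal.ofReal_ne_top))).add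
      (ENNReal.Tendsto.const_mul (a := 2) t2 (Or.inr (by simp)))).add
      (ENNReal.Tendsto.const_mul (a := 2) hQ.2 (Or.inr (by simp)))
    simp only [mul_zero, add_zero] at t3
    have t4 := t3.eventually_le_const (u := ENNReal.ofReal δ) (by simpa using hδ)
    filter_upwards [key δ hδ, t4] with n h1 h2
    refine h1.trans ((add_le_add_right h2 _).trans ?_)
    rw [← ENNReal.ofReal_add hδ.le hδ.le, two_mul]
  have hint : ∀ᶠ n in atTop, Integrable (X n) μ := by
    filter_upwards [hlim 1 one_pos] with n hn
    have : Integrable (fun ω => X n ω - x) μ :=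
      ⟨(hX n).sub aestronglyMeasurable_const, lt_of_le_of_lt hn (by simp)⟩
    exact (this.add (integrable_const x)).congr (ae_of_all _ fun ω => by simp)
  refine ⟨hint, ?_⟩
  rw [Metric.tendsto_nhds]
  intro ε hε
  filter_upwards [hint, hlim (ε / 4) (by positivity)] with n hi hn
  have h1 : ∫ ω, X n ω ∂μ - x = ∫ ω, (X n ω - x) ∂μ := by
    rw [integral_sub hi (integrable_const x)]
    simp
  have h2 := enorm_integral_le_lintegral_enorm (μ := μ) (fun ω => X n ω - x)
  rw [Real.dist_eq, h1]
  have h3 := h2.trans hn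
  rw [Real.enorm_eq_ofReal_abs, ENNReal.ofReal_le_ofReal_iff (by positivity)] at h3
  linarith

end LTwo

end PilotTraining

/-! ### Convergence of the normalised Gram matrix. -/

namespace PilotTraining

section MeanSquare

variable {ι κ : Type*} [Fintype ι] [Fintype κ]

theorem sum_norm_sq_add_le (A B : Matrix ι ι ℂ) :
    ∑ i, ∑ j, ‖(A + B) i j‖ ^ 2 ≤ 2 * ∑ i, ∑ j, ‖A i j‖ ^ 2 + 2 * ∑ i, ∑ j, ‖B i j‖ ^ 2 := by
  simp only [Finset.mul_sum, ← Finset.sum_add_distrib]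
  refine Finset.sum_le_sum fun i _ => Finset.sum_le_sum fun j _ => ?_
  have h := norm_add_le (A i j) (B i j)
  have := pow_le_pow_left₀ (norm_nonneg _) h 2
  rw [Matrix.add_apply]
  nlinarith [sq_nonneg (‖A i j‖ - ‖B i j‖)]

theorem sum_norm_sq_smul (a : ℂ) (A : Matrix ι ι ℂ) :
    ∑ i, ∑ j, ‖(a • A) i j‖ ^ 2 = ‖a‖ ^ 2 * ∑ i, ∑ j, ‖A i j‖ ^ 2 := by
  simp only [Finset.mul_sum, Matrix.smul_apply, smul_eq_mul, norm_mul, mul_pow]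

theorem sum_norm_sq_kronecker (A : Matrix ι ι ℂ) (B : Matrix κ κ ℂ) :
    ∑ x, ∑ y, ‖(A ⊗ₖ B) x y‖ ^ 2 = (∑ i, ∑ j, ‖A i j‖ ^ 2) * ∑ p, ∑ q, ‖B p q‖ ^ 2 := by
  simp only [Fintype.sum_prod_type, Matrix.kroneckerMap_apply, norm_mul, mul_pow]
  simp only [← Finset.mul_sum]
  simp only [← Finset.sum_mul]
  simp only [← Finset.mul_sum]
  simp only [← Finset.sum_mul]

/-- Bounds `tr A²`, the variance found above, by the squared Frobenius norm, which is multiplicative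
over Kronecker products. -/
theorem norm_sum_mul_swap_le (A : Matrix ι ι ℂ) :
    ‖∑ i, ∑ j, A i j * A j i‖ ≤ ∑ i, ∑ j, ‖A i j‖ ^ 2 := by
  have h1 : ‖∑ i, ∑ j, A i j * A j i‖ ≤ ∑ i, ∑ j, (‖A i j‖ ^ 2 / 2 + ‖A j i‖ ^ 2 / 2) := by
    refine (norm_sum_le _ _).trans (Finset.sum_le_sum fun i _ => ?_)
    refine (norm_sum_le _ _).trans (Finset.sum_le_sum fun j _ => ?_)
    rw [norm_mul]
    nlinarith [sq_nonneg (‖A i j‖ - ‖A j i‖)]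
  refine h1.trans (le_of_eq ?_)
  simp only [Finset.sum_add_distrib]
  rw [Finset.sum_comm (f := fun i j => ‖A j i‖ ^ 2 / 2), ← Finset.sum_add_distrib]
  refine Finset.sum_congr rfl fun i _ => ?_
  rw [← Finset.sum_add_distrib]
  exact Finset.sum_congr rfl fun j _ => by ring

end MeanSquare

theorem mul_star_eq_polarization (p q : ℂ) :
    p * star q = (1 / 4) * ((‖p + 1 * q‖ ^ 2 : ℝ) : ℂ) + (-(1 / 4)) * ((‖p + (-1) * q‖ ^ 2 : ℝ) : ℂ) +
      (Complex.I / 4) * ((‖p + Complex.I * q‖ ^ 2 : ℝ) : ℂ) +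
      (-(Complex.I / 4)) * ((‖p + (-Complex.I) * q‖ ^ 2 : ℝ) : ℂ) := by
  simp only [← Complex.normSq_eq_norm_sq, ← Complex.mul_conj]
  simp only [map_add, map_mul, map_neg, map_one, Complex.conj_I, RCLike.star_def]
  ring_nf
  simp only [Complex.I_sq]
  ring

theorem IsCircularGaussian.ofReal_re_trace {Ω ι : Type*} [MeasurableSpace Ω] [Fintype ι]
    {μ : Measure Ω} {f : ι → Ω → ℂ} {Γ : Matrix ι ι ℂ} (hf : IsCircularGaussian μ f Γ) :
    ((Γ.trace.re : ℝ) : ℂ) = Γ.trace := by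
  rw [Matrix.trace, Complex.re_sum, Complex.ofReal_sum]
  refine Finset.sum_congr rfl fun x _ => ?_
  rw [Matrix.diag, ← hf.integral_norm_sq x, Complex.ofReal_re]

namespace Setup

variable {N L : ℕ} (S : Setup N L) {NT : ℕ} {Ω : Type*} [MeasurableSpace Ω] {μ : Measure Ω}

theorem rowComb_add_mul (hL : L ≤ N) (a a' c c' : Fin 2 → ℂ) (t : ℂ)
    (h : Fin 2 → Fin NT × Fin L → ℂ) (w : Fin NT × Fin 2 × Fin N → ℂ) (x : Fin NT × S.P) :
    S.rowComb hL (fun u => a u + t * a' u) (fun k => c k + t * c' k) h w x =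
      S.rowComb hL a c h w x + t * S.rowComb hL a' c' h w x := by
  simp only [rowComb, add_mul, Finset.sum_add_distrib, mul_add, Finset.mul_sum]
  simp only [mul_assoc]
  ring

/-- The limiting value of the normalised inner product of two row combinations. -/
noncomputable def limitForm (σ2 : ℝ) (a c a' c' : Fin 2 → ℂ) : ℂ :=
  ∑ u, a u * star (a' u) + σ2 * ∑ k, c k * star (c' k)

theorem trace_rowComb_cov (hL0 : 0 < L) (hL : L ≤ N) (hΔ : 0 < S.Δ) (NT : ℕ) (σ2 : ℝ)
    (a c : Fin 2 → ℂ) :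
    (S.channelCov hL NT a + ((σ2 : ℂ) * ∑ k, c k * star (c k)) •
      (1 : Matrix (Fin NT × S.P) (Fin NT × S.P) ℂ)).trace =
      ((NT : ℂ) * S.s) * limitForm σ2 a c a c := by
  have hLc : (L : ℂ) ≠ 0 := by exact_mod_cast hL0.ne'
  have hR (u : Fin 2) : (S.R NT u).trace = NT / L := by
    simp only [Matrix.trace, Matrix.diag, S.R_self hΔ]
    simp
    field_simp
  have hQ : (S.FLs hL * (S.FLs hL)ᴴ).trace = S.s * L := by
    simp only [Matrix.trace, Matrix.diag, Matrix.mul_apply, Matrix.conjTranspose_apply,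
      FLs_mul_star]
    simp [s]
  rw [channelCov, Matrix.trace_add, Matrix.trace_add, Matrix.trace_smul, Matrix.trace_smul,
    Matrix.trace_smul, Matrix.trace_kronecker, Matrix.trace_kronecker, hR, hR, hQ,
    Matrix.trace_one, limitForm, Fintype.card_prod, Fintype.card_fin,
    Fintype.card_coe]
  simp only [smul_eq_mul, s, Fin.sum_univ_two]
  push_cast
  field_simp

/-- The channel terms reduce to the mean squares of `R_u`, times a factor independent of `NT`. The
identity has squared Frobenius norm `NT s` and contributes `O(1 / NT)`. The constants `4` and `2`
come from using `|p + q|² ≤ 2 |p|² + 2 |q|²` twice and once. -/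
theorem tendsto_mean_sq_cov (hP : S.P.Nonempty) (hD : 0 < S.D) (hΔ : 0 < S.Δ)
    (hL : L ≤ N) (a : Fin 2 → ℂ) (b : ℂ) :
    Tendsto (fun NT : ℕ => (1 / ((NT : ℝ) * S.s) ^ 2) * ∑ x, ∑ y,
      ‖(S.channelCov hL NT a + b • (1 : Matrix (Fin NT × S.P) (Fin NT × S.P) ℂ)) x y‖ ^ 2)
      atTop (𝓝 0) := by
  have hs : (0 : ℝ) < S.s := by exact_mod_cast hP.card_pos
  set q := ∑ p, ∑ q, ‖(S.FLs hL * (S.FLs hL)ᴴ) p q‖ ^ 2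
  have h0 := (S.tendsto_mean_sq_R hD hΔ 0).const_mul (4 * ‖a 0 * star (a 0)‖ ^ 2 * q / S.s ^ 2)
  have h1 := (S.tendsto_mean_sq_R hD hΔ 1).const_mul (4 * ‖a 1 * star (a 1)‖ ^ 2 * q / S.s ^ 2)
  have h2 := tendsto_const_div_atTop_nhds_zero_nat (2 * ‖b‖ ^ 2 / (S.s : ℝ))
  have h3 := (h0.add h1).add h2
  simp only [mul_zero, add_zero] at h3
  refine squeeze_zero (fun NT => by positivity) (fun NT => ?_) h3
  have e1 := sum_norm_sq_add_le (S.channelCov hL NT a)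
    (b • (1 : Matrix (Fin NT × S.P) (Fin NT × S.P) ℂ))
  have e2 := sum_norm_sq_add_le ((a 0 * star (a 0)) • S.R NT 0 ⊗ₖ (S.FLs hL * (S.FLs hL)ᴴ))
    ((a 1 * star (a 1)) • S.R NT 1 ⊗ₖ (S.FLs hL * (S.FLs hL)ᴴ))
  have e3 : ∑ x, ∑ y, ‖(1 : Matrix (Fin NT × S.P) (Fin NT × S.P) ℂ) x y‖ ^ 2 = NT * S.s := by
    simp only [Matrix.one_apply, apply_ite norm, norm_one, norm_zero, ite_pow, one_pow]
    simp [s]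
  rw [sum_norm_sq_smul, sum_norm_sq_smul, sum_norm_sq_kronecker, sum_norm_sq_kronecker] at e2
  rw [sum_norm_sq_smul, e3] at e1
  change _ ≤ 2 * ∑ x, ∑ y, ‖S.channelCov hL NT a x y‖ ^ 2 + _ at e1
  change ∑ x, ∑ y, ‖S.channelCov hL NT a x y‖ ^ 2 ≤ _ at e2
  rcases Nat.eq_zero_or_pos NT with rfl | hNT
  · simp
  have hn : (0 : ℝ) < NT := by exact_mod_cast hNT
  calc _ ≤ 1 / ((NT : ℝ) * S.s) ^ 2 * (2 * (2 * (‖a 0 * star (a 0)‖ ^ 2 *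
        ((∑ i, ∑ j, ‖S.R NT 0 i j‖ ^ 2) * q)) + 2 * (‖a 1 * star (a 1)‖ ^ 2 *
        ((∑ i, ∑ j, ‖S.R NT 1 i j‖ ^ 2) * q))) + 2 * (‖b‖ ^ 2 * (NT * S.s))) := by
        gcongr
        linarith
    _ = _ := by
        field_simp
        ring

variable {σ2 : ℝ} {h : (NT : ℕ) → Fin 2 → Fin NT × Fin L → Ω → ℂ}
  {w : (NT : ℕ) → Fin NT × Fin 2 × Fin N → Ω → ℂ}

/-- For `NT > 0` the normalised mean equals the limit exactly, so the mean-square distance is the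
variance alone. -/
theorem tendstoLTwo_norm_sq_rowComb [IsProbabilityMeasure μ] (hL0 : 0 < L) (hL : L ≤ N)
    (hP : S.P.Nonempty) (hD : 0 < S.D) (hΔ : 0 < S.Δ)
    (hm : ∀ NT, S.IsModel μ NT σ2 (h NT) (w NT)) (a c : Fin 2 → ℂ) :
    TendstoLTwo μ (fun NT ω => (1 / ((NT : ℂ) * S.s)) * ((∑ x, ‖S.rowComb hL a c
      (fun v y => h NT v y ω) (fun y => w NT y ω) x‖ ^ 2 : ℝ) : ℂ)) (limitForm σ2 a c a c) := by
  have hG (NT : ℕ) := (hm NT).isCircularGaussian_rowComb S hL a c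
  have hs : (0 : ℝ) < S.s := by exact_mod_cast hP.card_pos
  refine ⟨fun NT => ?_, ?_⟩
  · have hx (x) : AEMeasurable (fun ω => S.rowComb hL a c
      (fun v y => h NT v y ω) (fun y => w NT y ω) x) μ := (hG NT).aemeasurable x
    exact AEMeasurable.aestronglyMeasurable (by fun_prop)
  · have h0 := S.tendsto_mean_sq_cov hP hD hΔ hL a ((σ2 : ℂ) * ∑ k, c k * star (c k))
    have h1 : Tendsto (fun NT : ℕ => ENNReal.ofReal (((1 / ((NT : ℝ) * S.s) ^ 2) * ∑ x, ∑ y,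
      ‖(S.channelCov hL NT a + ((σ2 : ℂ) * ∑ k, c k * star (c k)) •
        (1 : Matrix (Fin NT × S.P) (Fin NT × S.P) ℂ)) x y‖ ^ 2) ^ (2⁻¹ : ℝ))) atTop (𝓝 0) := by
      have := ENNReal.tendsto_ofReal (h0.rpow_const (p := (2⁻¹ : ℝ)) (Or.inr (by norm_num)))
      simpa using this
    refine tendsto_of_tendsto_of_tendsto_of_le_of_le' tendsto_const_nhds h1
      (Eventually.of_forall fun _ => zero_le) ?_
    filter_upwards [eventually_gt_atTop 0] with NT hNT
    have hn : (0 : ℝ) < NT := by exact_mod_cast hNT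
    set Γ := (S.channelCov hL NT a + ((σ2 : ℂ) * ∑ k, c k * star (c k)) •
        (1 : Matrix (Fin NT × S.P) (Fin NT × S.P) ℂ)) with hΓ
    set f : Ω → ℝ := fun ω => ∑ x, ‖S.rowComb hL a c
      (fun v y => h NT v y ω) (fun y => w NT y ω) x‖ ^ 2 with hf
    have hvar : ((∫ ω, (f ω - Γ.trace.re) ^ 2 ∂μ : ℝ) : ℂ) = ∑ j, ∑ k, Γ j k * Γ k j :=
      (hG NT).integral_sum_norm_sq_sub_trace_sq
    have hfL : MemLp (fun ω => f ω - Γ.trace.re) 2 μ := by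
      refine MemLp.sub ?_ (memLp_const _)
      exact memLp_finsetSum _ fun x _ => (hG NT).memLp_norm_sq x
    have htr := S.trace_rowComb_cov hL0 hL hΔ NT σ2 a c
    rw [← hΓ] at htr
    have hre : ((Γ.trace.re : ℝ) : ℂ) = Γ.trace := (hG NT).ofReal_re_trace
    have hnc : (NT : ℂ) * S.s ≠ 0 := by
      have : ((NT : ℝ) * S.s) ≠ 0 := by positivity
      exact_mod_cast this
    have hfun : (fun ω => (1 / ((NT : ℂ) * S.s)) * ((f ω : ℝ) : ℂ) - limitForm σ2 a c a c) =
        fun ω => (1 / ((NT : ℂ) * S.s)) * ((f ω - Γ.trace.re : ℝ) : ℂ) := by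
      funext ω
      rw [Complex.ofReal_sub, hre, htr, mul_sub, one_div, inv_mul_cancel_left₀ hnc]
    have hnorm (ω : Ω) : ‖(1 / ((NT : ℂ) * S.s)) * ((f ω - Γ.trace.re : ℝ) : ℂ)‖ =
        ‖(1 / ((NT : ℝ) * S.s)) * (f ω - Γ.trace.re)‖ := by
      rw [norm_mul, norm_mul, Complex.norm_real]
      congr 1
      simp
    rw [hfun, eLpNorm_congr_norm_ae (ae_of_all _ hnorm),
      MemLp.eLpNorm_eq_integral_rpow_norm two_ne_zero (by simp) (hfL.const_mul _)]
    simp only [ENNReal.toReal_ofNat, Real.rpow_two, norm_mul, mul_pow, Real.norm_eq_abs, sq_abs]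
    rw [integral_const_mul]
    apply ENNReal.ofReal_le_ofReal
    have hv : ∫ ω, (f ω - Γ.trace.re) ^ 2 ∂μ ≤ ∑ x, ∑ y, ‖Γ x y‖ ^ 2 := by
      refine le_trans (le_abs_self _) ?_
      rw [← Real.norm_eq_abs, ← Complex.norm_real, hvar]
      exact norm_sum_mul_swap_le Γ
    have hv0 : 0 ≤ ∫ ω, (f ω - Γ.trace.re) ^ 2 ∂μ := integral_nonneg fun _ => sq_nonneg _
    rw [div_pow, one_pow]
    gcongr
    exact (mul_pow _ _ 2).ge

/-- The normalised inner products of row combinations converge in mean square. -/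
theorem tendstoLTwo_inner_rowComb [IsProbabilityMeasure μ] (hL0 : 0 < L) (hL : L ≤ N)
    (hP : S.P.Nonempty) (hD : 0 < S.D) (hΔ : 0 < S.Δ)
    (hm : ∀ NT, S.IsModel μ NT σ2 (h NT) (w NT)) (a c a' c' : Fin 2 → ℂ) :
    TendstoLTwo μ (fun NT ω => (1 / ((NT : ℂ) * S.s)) * ∑ x,
      S.rowComb hL a c (fun v y => h NT v y ω) (fun y => w NT y ω) x *
      star (S.rowComb hL a' c' (fun v y => h NT v y ω) (fun y => w NT y ω) x))
      (limitForm σ2 a c a' c') := by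
  have hq (t : ℂ) := S.tendstoLTwo_norm_sq_rowComb hL0 hL hP hD hΔ hm
    (fun u => a u + t * a' u) (fun k => c k + t * c' k)
  have := ((((hq 1).const_mul (1 / 4)).add ((hq (-1)).const_mul (-(1 / 4)))).add
    ((hq Complex.I).const_mul (Complex.I / 4))).add
    ((hq (-Complex.I)).const_mul (-(Complex.I / 4)))
  convert! this using 1
  · funext NT ω
    simp only [mul_star_eq_polarization, rowComb_add_mul, Complex.ofReal_sum,
      Finset.sum_add_distrib, ← Finset.mul_sum]
    ring
  · simp only [limitForm, Fin.sum_univ_two, star_add, star_mul', star_neg, star_one,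
      RCLike.star_def, Complex.conj_I]
    ring_nf
    simp only [Complex.I_sq]
    ring

end Setup

end PilotTraining

/-! ### The error as a function of the Gram matrix, and its limit. -/

namespace PilotTraining

open scoped ENNReal

section LinearEstimation

variable {ι : Type*} [Fintype ι]

theorem mul_star_self_eq (z : ℂ) : z * star z = ((‖z‖ ^ 2 : ℝ) : ℂ) := by
  rw [RCLike.star_def, Complex.mul_conj, Complex.normSq_eq_norm_sq]

theorem vecMul_gram_dotProduct (y : Matrix (Fin 2) ι ℂ) (r : ℝ) (W : Fin 2 → ℂ) :
    (W ᵥ* ((r : ℂ) • (y * yᴴ))) ⬝ᵥ star W = ((r * ∑ x, ‖(W ᵥ* y) x‖ ^ 2 : ℝ) : ℂ) := by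
  rw [Matrix.vecMul_smul, smul_dotProduct, ← Matrix.vecMul_vecMul, ← Matrix.dotProduct_mulVec,
    ← Matrix.star_vecMul]
  simp only [dotProduct, Pi.star_apply, mul_star_self_eq, smul_eq_mul]
  push_cast
  rfl

/-- The normalised squared error of the linear estimate with weights `W`, in terms of the
sample covariance `C`, the sample cross-covariance `K` and the sample power `κ`. -/
noncomputable def errorForm (W : Fin 2 → ℂ) (C : Matrix (Fin 2) (Fin 2) ℂ) (K : Fin 2 → ℂ)
    (κ : ℂ) : ℝ :=
  ((W ᵥ* C) ⬝ᵥ star W).re - 2 * (W ⬝ᵥ K).re + κ.re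

theorem mul_sum_norm_sub_sq_eq (y : Matrix (Fin 2) ι ℂ) (h : ι → ℂ) (r : ℝ) (W : Fin 2 → ℂ) :
    r * ∑ x, ‖(W ᵥ* y) x - h x‖ ^ 2 = errorForm W ((r : ℂ) • (y * yᴴ))
      (fun k => (r : ℂ) * ∑ x, y k x * star (h x)) ((r : ℂ) * ∑ x, h x * star (h x)) := by
  have hp (p q : ℂ) : ‖p - q‖ ^ 2 = ‖p‖ ^ 2 - 2 * (p * star q).re + ‖q‖ ^ 2 := by
    simp only [← Complex.normSq_eq_norm_sq, Complex.normSq_apply, Complex.sub_re, Complex.sub_im,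
      Complex.mul_re, RCLike.star_def, Complex.conj_re, Complex.conj_im]
    ring
  have hK : W ⬝ᵥ (fun k => (r : ℂ) * ∑ x, y k x * star (h x)) =
      (r : ℂ) * ∑ x, (W ᵥ* y) x * star (h x) := by
    simp only [Matrix.vecMul, dotProduct, Finset.mul_sum, Finset.sum_mul]
    rw [Finset.sum_comm]
    exact Finset.sum_congr rfl fun _ _ => Finset.sum_congr rfl fun _ _ => by ring
  rw [errorForm, vecMul_gram_dotProduct, hK, Complex.ofReal_re, Complex.re_ofReal_mul,
    Complex.re_ofReal_mul, Complex.re_sum, Complex.re_sum]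
  simp only [hp, Finset.sum_add_distrib, Finset.sum_sub_distrib, mul_star_self_eq,
    Complex.ofReal_re, ← Finset.mul_sum]
  ring

/-- Valid for singular `C` too, where both sides are `0`. -/
theorem inv_fin_two (C : Matrix (Fin 2) (Fin 2) ℂ) : C⁻¹ = C.det⁻¹ • C.adjugate := by
  rw [Matrix.inv_def, Ring.inverse_eq_inv']

/-- The power of the LMMSE estimate. -/
theorem mul_sum_norm_estimate_sq_le (y : Matrix (Fin 2) ι ℂ) {r : ℝ} (hr : 0 ≤ r)
    (x : Fin 2 → ℂ) :
    r * ∑ i, ‖((star x ᵥ* ((r : ℂ) • (y * yᴴ))⁻¹) ᵥ* y) i‖ ^ 2 ≤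
      ‖(star x ᵥ* ((r : ℂ) • (y * yᴴ)).adjugate) ⬝ᵥ x‖ * ‖((r : ℂ) • (y * yᴴ)).det‖⁻¹ := by
  set C := (r : ℂ) • (y * yᴴ) with hC
  have hH : Cᴴ = C := by
    rw [hC, Matrix.conjTranspose_smul, Matrix.conjTranspose_mul, Matrix.conjTranspose_conjTranspose]
    simp
  have h0 : 0 ≤ r * ∑ i, ‖((star x ᵥ* C⁻¹) ᵥ* y) i‖ ^ 2 := by positivity
  have h1 := vecMul_gram_dotProduct y r (star x ᵥ* C⁻¹)
  rw [← hC] at h1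
  rw [← abs_of_nonneg h0, ← Real.norm_eq_abs, ← Complex.norm_real, ← h1]
  by_cases hd : C.det = 0
  · rw [inv_fin_two, hd]
    simp
  -- For `W = xᴴ C⁻¹` the output power `W C Wᴴ` collapses to `xᴴ C⁻¹ x`, so only one inverse
  -- determinant appears.
  · have hu : IsUnit C.det := isUnit_iff_ne_zero.2 hd
    rw [Matrix.vecMul_vecMul, Matrix.nonsing_inv_mul _ hu, Matrix.vecMul_one, Matrix.star_vecMul,
      star_star, Matrix.conjTranspose_nonsing_inv, hH, inv_fin_two, Matrix.smul_mulVec,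
      dotProduct_smul, smul_eq_mul, norm_mul, norm_inv, mul_comm, Matrix.dotProduct_mulVec]

theorem mul_sum_norm_estimate_sub_sq_le (y : Matrix (Fin 2) ι ℂ) (h : ι → ℂ) {r : ℝ}
    (hr : 0 ≤ r) (x : Fin 2 → ℂ) :
    r * ∑ i, ‖((star x ᵥ* ((r : ℂ) • (y * yᴴ))⁻¹) ᵥ* y) i - h i‖ ^ 2 ≤
      2 * (‖(star x ᵥ* ((r : ℂ) • (y * yᴴ)).adjugate) ⬝ᵥ x‖ * ‖((r : ℂ) • (y * yᴴ)).det‖⁻¹) +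
        2 * ‖(r : ℂ) * ∑ i, h i * star (h i)‖ := by
  have h1 := mul_sum_norm_estimate_sq_le y hr x
  set e := ((star x ᵥ* ((r : ℂ) • (y * yᴴ))⁻¹) ᵥ* y)
  have h2 : ‖(r : ℂ) * ∑ i, h i * star (h i)‖ = r * ∑ i, ‖h i‖ ^ 2 := by
    simp only [mul_star_self_eq]
    rw [← Complex.ofReal_sum, ← Complex.ofReal_mul, Complex.norm_real, Real.norm_of_nonneg]
    positivity
  have h3 : ∑ i, ‖e i - h i‖ ^ 2 ≤ 2 * ∑ i, ‖e i‖ ^ 2 + 2 * ∑ i, ‖h i‖ ^ 2 := by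
    rw [Finset.mul_sum, Finset.mul_sum, ← Finset.sum_add_distrib]
    refine Finset.sum_le_sum fun i _ => ?_
    have := pow_le_pow_left₀ (norm_nonneg _) (norm_sub_le (e i) (h i)) 2
    nlinarith [sq_nonneg (‖e i‖ - ‖h i‖)]
  have h4 := mul_le_mul_of_nonneg_left h3 hr
  rw [h2]
  linarith

end LinearEstimation

section ErrorFunction

/-- The Gram matrix of the observations, as a block of the Gram matrix of the observations and
the estimated row. -/
def obsGram (g : (Fin 2 ⊕ Unit) × (Fin 2 ⊕ Unit) → ℂ) : Matrix (Fin 2) (Fin 2) ℂ :=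
  Matrix.of fun k l => g (Sum.inl k, Sum.inl l)

/-- The normalised squared error of the LMMSE estimate as a function of a Gram matrix. -/
noncomputable def gramError (x : Fin 2 → ℂ) (g : (Fin 2 ⊕ Unit) × (Fin 2 ⊕ Unit) → ℂ) : ℝ :=
  errorForm (star x ᵥ* (obsGram g)⁻¹) (obsGram g) (fun k => g (Sum.inl k, Sum.inr ()))
    (g (Sum.inr (), Sum.inr ()))

theorem measurable_gramError (x : Fin 2 → ℂ) : Measurable (gramError x) := by
  unfold gramError errorForm
  simp only [inv_fin_two, Matrix.adjugate_fin_two, Matrix.det_fin_two, Matrix.vecMul, dotProduct,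
    Fin.sum_univ_two, Matrix.smul_apply, Matrix.of_apply, Matrix.cons_val', Matrix.cons_val_zero,
    Matrix.cons_val_one, Matrix.cons_val_fin_one, obsGram, Pi.star_apply, smul_eq_mul]
  fun_prop

theorem continuousAt_gramError (x : Fin 2 → ℂ) {g : (Fin 2 ⊕ Unit) × (Fin 2 ⊕ Unit) → ℂ}
    (hg : (obsGram g).det ≠ 0) : ContinuousAt (gramError x) g := by
  have h1 : ContinuousAt (fun g' => (obsGram g').det⁻¹) g := by
    refine ContinuousAt.inv₀ ?_ hg
    simp only [Matrix.det_fin_two, obsGram, Matrix.of_apply]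
    fun_prop
  have h2 : Continuous fun p : ℂ × ((Fin 2 ⊕ Unit) × (Fin 2 ⊕ Unit) → ℂ) =>
      errorForm (star x ᵥ* (p.1 • (obsGram p.2).adjugate)) (obsGram p.2)
        (fun k => p.2 (Sum.inl k, Sum.inr ())) (p.2 (Sum.inr (), Sum.inr ())) := by
    unfold errorForm
    simp only [Matrix.adjugate_fin_two, Matrix.vecMul, dotProduct, obsGram,
      Fin.sum_univ_two, Matrix.smul_apply, Matrix.of_apply, Matrix.cons_val', Matrix.cons_val_zero,
      Matrix.cons_val_one, Matrix.cons_val_fin_one, Pi.star_apply, smul_eq_mul]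
    fun_prop
  unfold gramError
  simp only [inv_fin_two]
  exact ContinuousAt.comp (f := fun g' => ((obsGram g').det⁻¹, g')) h2.continuousAt
    (h1.prodMk continuousAt_id)

end ErrorFunction

namespace Setup

variable {N L : ℕ} (S : Setup N L)

/-- The limiting covariance matrix of the observations. -/
noncomputable def limitCov (σ2 : ℝ) : Matrix (Fin 2) (Fin 2) ℂ :=
  S.X * S.Xᴴ + (σ2 : ℂ) • 1

theorem X_mul_star (hρ : ∀ u, 0 < S.ρ u) (k u : Fin 2) :
    S.X k u * star (S.X k u) = S.ρ u := by
  rw [mul_star_self_eq]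
  congr 1
  have : ‖Complex.exp (Complex.I * S.φ u k)‖ = 1 := by
    rw [mul_comm]
    exact Complex.norm_exp_ofReal_mul_I _
  simp only [X, Matrix.of_apply, norm_mul, this, mul_one, Complex.norm_real, Real.norm_eq_abs,
    sq_abs]
  exact Real.sq_sqrt (hρ u).le

/-- The characteristic polynomial of `X Xᴴ`: its trace is `2 (ρ_0 + ρ_1)`, since each pilot has two
symbols of power `ρ_u`. -/
theorem det_limitCov (hρ : ∀ u, 0 < S.ρ u) (σ2 : ℝ) :
    (S.limitCov σ2).det =
      ((‖S.X.det‖ ^ 2 + 2 * (S.ρ 0 + S.ρ 1) * σ2 + σ2 ^ 2 : ℝ) : ℂ) := by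
  have h00 := S.X_mul_star hρ 0 0
  have h10 := S.X_mul_star hρ 1 0
  have h01 := S.X_mul_star hρ 0 1
  have h11 := S.X_mul_star hρ 1 1
  push_cast
  rw [← Complex.ofReal_pow, ← mul_star_self_eq, Matrix.det_fin_two, Matrix.det_fin_two]
  simp only [limitCov, Matrix.add_apply, Matrix.mul_apply, Matrix.conjTranspose_apply,
    Fin.sum_univ_two, Matrix.smul_apply, Matrix.one_apply, star_sub, star_mul']
  simp only [Fin.isValue, ite_true, zero_ne_one, one_ne_zero, ite_false, smul_eq_mul, mul_one,
    mul_zero, add_zero]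
  linear_combination (σ2 : ℂ) * (h00 + h10 + h01 + h11)

/-- In size two `adj (X Xᴴ + σ² I) = adj(X)ᴴ adj(X) + σ² I`, while `adj(X) x_u = det X · e_u` and
`‖x_u‖² = 2 ρ_u`. -/
theorem star_pilot_adjugate_limitCov (hρ : ∀ u, 0 < S.ρ u) (σ2 : ℝ) (u : Fin 2) :
    (star (S.pilot u) ᵥ* (S.limitCov σ2).adjugate) ⬝ᵥ S.pilot u =
      ((‖S.X.det‖ ^ 2 + 2 * S.ρ u * σ2 : ℝ) : ℂ) := by
  have h0 := S.X_mul_star hρ 0 u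
  have h1 := S.X_mul_star hρ 1 u
  push_cast
  rw [← Complex.ofReal_pow, ← mul_star_self_eq, Matrix.det_fin_two, Matrix.adjugate_fin_two]
  simp only [Matrix.vecMul, dotProduct, Fin.sum_univ_two, Pi.star_apply, pilot, limitCov,
    Matrix.add_apply, Matrix.mul_apply, Matrix.conjTranspose_apply, Matrix.smul_apply,
    Matrix.one_apply, star_sub, star_mul', Matrix.of_apply, Matrix.cons_val', Matrix.cons_val_zero,
    Matrix.cons_val_one, Matrix.cons_val_fin_one]
  simp only [Fin.isValue, ite_true, zero_ne_one, one_ne_zero, ite_false, smul_eq_mul, mul_one,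
    mul_zero, add_zero]
  fin_cases u
  · simp only [Fin.zero_eta, Fin.isValue] at h0 h1 ⊢
    linear_combination (σ2 : ℂ) * (h0 + h1)
  · simp only [Fin.mk_one, Fin.isValue] at h0 h1 ⊢
    linear_combination (σ2 : ℂ) * (h0 + h1)

/-- The large-array limit of the normalised mean square error. -/
noncomputable def limitError (u : Fin 2) (σ2 : ℝ) : ℝ :=
  1 - (‖S.X.det‖ ^ 2 + 2 * S.ρ u * σ2) / (‖S.X.det‖ ^ 2 + 2 * (S.ρ 0 + S.ρ 1) * σ2 + σ2 ^ 2)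

theorem exists_tendsto_limitError (hρ : ∀ u, 0 < S.ρ u)
    (hX : IsUnit S.X.det ∨ S.ρ 0 = S.ρ 1) :
    ∃ e : ℝ, ∀ u, Tendsto (S.limitError u) (𝓝[>] 0) (𝓝 e) := by
  by_cases hd : S.X.det = 0
  · have h01 : S.ρ 0 = S.ρ 1 := hX.resolve_left (by simp [hd])
    have hu (u : Fin 2) : S.ρ u = S.ρ 0 := by
      fin_cases u
      · rfl
      · exact h01.symm
    have h0 := hρ 0
    -- With `det X = 0` and equal powers, a factor `σ²` cancels and leaves `1 - 2 ρ / (4 ρ + σ²)`.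
    refine ⟨1 / 2, fun u => ?_⟩
    have hc : ContinuousAt (fun t : ℝ => 1 - 2 * S.ρ 0 / (4 * S.ρ 0 + t)) 0 := by
      refine continuousAt_const.sub (continuousAt_const.div (by fun_prop) ?_)
      simpa using h0.ne'
    have ht : Tendsto (fun t : ℝ => 1 - 2 * S.ρ 0 / (4 * S.ρ 0 + t)) (𝓝[>] 0) (𝓝 (1 / 2)) := by
      have := hc.tendsto.mono_left (nhdsWithin_le_nhds (s := Set.Ioi 0))
      convert! this using 2
      field_simp
      ring
    refine ht.congr' ?_
    filter_upwards [self_mem_nhdsWithin] with t ht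
    have ht : 0 < t := ht
    rw [limitError, hd, hu u, ← h01]
    simp only [norm_zero]
    field_simp
    ring
  -- With `det X ≠ 0` the quotient is continuous at `σ² = 0`, with value `1`.
  · refine ⟨0, fun u => ?_⟩
    have hn : ‖S.X.det‖ ^ 2 ≠ 0 := by simpa using hd
    have hc : ContinuousAt (S.limitError u) 0 := by
      unfold limitError
      refine continuousAt_const.sub (ContinuousAt.div (by fun_prop) (by fun_prop) ?_)
      simpa using hd
    have := hc.tendsto.mono_left (nhdsWithin_le_nhds (s := Set.Ioi 0))
    convert! this using 2
    simp [limitError, hn]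

theorem limitCov_det_ne_zero (hρ : ∀ u, 0 < S.ρ u) {σ2 : ℝ} (hσ : 0 < σ2) :
    (S.limitCov σ2).det ≠ 0 := by
  rw [det_limitCov S hρ]
  have h0 := hρ 0
  have h1 := hρ 1
  have : 0 < ‖S.X.det‖ ^ 2 + 2 * (S.ρ 0 + S.ρ 1) * σ2 + σ2 ^ 2 := by positivity
  exact_mod_cast this.ne'

/-- With `t = x_uᴴ C⁻¹ x_u`, which is real, output power and cross term both equal `t`, so the error
is `t - 2 t + 1`. -/
theorem errorForm_limit (hρ : ∀ u, 0 < S.ρ u) {σ2 : ℝ} (hσ : 0 < σ2) (u : Fin 2) :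
    errorForm (star (S.pilot u) ᵥ* (S.limitCov σ2)⁻¹) (S.limitCov σ2) (S.pilot u) 1 =
      S.limitError u σ2 := by
  have hu := isUnit_iff_ne_zero.2 (S.limitCov_det_ne_zero hρ hσ)
  have ht : (star (S.pilot u) ᵥ* (S.limitCov σ2)⁻¹) ⬝ᵥ S.pilot u =
      (((‖S.X.det‖ ^ 2 + 2 * S.ρ u * σ2) /
        (‖S.X.det‖ ^ 2 + 2 * (S.ρ 0 + S.ρ 1) * σ2 + σ2 ^ 2) : ℝ) : ℂ) := by
    rw [inv_fin_two, Matrix.vecMul_smul, smul_dotProduct, star_pilot_adjugate_limitCov S hρ,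
      det_limitCov S hρ, Complex.ofReal_div, smul_eq_mul, div_eq_inv_mul]
  have h1 : ((star (S.pilot u) ᵥ* (S.limitCov σ2)⁻¹) ᵥ* S.limitCov σ2) ⬝ᵥ
      star (star (S.pilot u) ᵥ* (S.limitCov σ2)⁻¹) =
      star ((star (S.pilot u) ᵥ* (S.limitCov σ2)⁻¹) ⬝ᵥ S.pilot u) := by
    rw [Matrix.vecMul_vecMul, Matrix.nonsing_inv_mul _ hu, Matrix.vecMul_one,
      ← Matrix.star_dotProduct_star]
  rw [errorForm, h1, ht, RCLike.star_def, Complex.conj_ofReal, Complex.ofReal_re, Complex.one_re,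
    limitError]
  ring

variable {NT : ℕ} {Ω : Type*} [MeasurableSpace Ω] {μ : Measure Ω}

/-- Channel coefficients of the observations and of the channel of user `u`. -/
noncomputable def channelCoeff (u : Fin 2) : Fin 2 ⊕ Unit → Fin 2 → ℂ :=
  Sum.elim (fun k => S.X k) fun _ => Pi.single u 1

/-- Noise coefficients of the observations and of the channel of user `u`. -/
def noiseCoeff : Fin 2 ⊕ Unit → Fin 2 → ℂ := Sum.elim (fun k => Pi.single k 1) fun _ => 0

/-- The normalised Gram matrix of the observations and of the channel of user `u`. -/
noncomputable def fullGram (hL : L ≤ N) (u : Fin 2) (h : Fin 2 → Fin NT × Fin L → ℂ)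
    (w : Fin NT × Fin 2 × Fin N → ℂ) : (Fin 2 ⊕ Unit) × (Fin 2 ⊕ Unit) → ℂ := fun r =>
  (1 / ((NT : ℂ) * S.s)) * ∑ x, S.rowComb hL (S.channelCoeff u r.1) (noiseCoeff r.1) h w x *
    star (S.rowComb hL (S.channelCoeff u r.2) (noiseCoeff r.2) h w x)

/-- The limit of `fullGram`. -/
noncomputable def limitGram (σ2 : ℝ) (u : Fin 2) : (Fin 2 ⊕ Unit) × (Fin 2 ⊕ Unit) → ℂ := fun r =>
  limitForm σ2 (S.channelCoeff u r.1) (noiseCoeff r.1) (S.channelCoeff u r.2) (noiseCoeff r.2)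

theorem rowComb_inl (hL : L ≤ N) (u k : Fin 2) (h : Fin 2 → Fin NT × Fin L → ℂ)
    (w : Fin NT × Fin 2 × Fin N → ℂ) (x : Fin NT × S.P) :
    S.rowComb hL (S.channelCoeff u (Sum.inl k)) (noiseCoeff (Sum.inl k)) h w x =
      S.Y hL h w k x := by
  simp [rowComb, channelCoeff, noiseCoeff, Y, Matrix.mul_apply, Pi.single_apply]

theorem rowComb_inr (hL : L ≤ N) (u : Fin 2) (h : Fin 2 → Fin NT × Fin L → ℂ)
    (w : Fin NT × Fin 2 × Fin N → ℂ) (x : Fin NT × S.P) :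
    S.rowComb hL (S.channelCoeff u (Sum.inr ())) (noiseCoeff (Sum.inr ())) h w x =
      S.H hL h u x := by
  simp [rowComb, channelCoeff, noiseCoeff, Pi.single_apply]

theorem obsGram_fullGram (hL : L ≤ N) (u : Fin 2) (h : Fin 2 → Fin NT × Fin L → ℂ)
    (w : Fin NT × Fin 2 × Fin N → ℂ) : obsGram (S.fullGram hL u h w) = S.C hL h w := by
  ext k l
  simp [obsGram, fullGram, C, rowComb_inl, Matrix.mul_apply]

theorem obsGram_limitGram (σ2 : ℝ) (u : Fin 2) :
    obsGram (S.limitGram σ2 u) = S.limitCov σ2 := by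
  ext k l
  simp [obsGram, limitGram, limitForm, limitCov, channelCoeff, noiseCoeff, Matrix.mul_apply,
    Matrix.one_apply, Pi.single_apply, apply_ite (starRingEnd ℂ), eq_comm]

theorem gramError_limitGram (hρ : ∀ u, 0 < S.ρ u) {σ2 : ℝ} (hσ : 0 < σ2) (u : Fin 2) :
    gramError (S.pilot u) (S.limitGram σ2 u) = S.limitError u σ2 := by
  rw [← errorForm_limit S hρ hσ, gramError, obsGram_limitGram]
  congr 1
  · funext k
    simp [limitGram, limitForm, channelCoeff, noiseCoeff, pilot, Pi.single_apply,
      apply_ite (starRingEnd ℂ)]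
  · simp [limitGram, limitForm, channelCoeff, noiseCoeff, Pi.single_apply]

theorem C_eq_ofReal_smul (hL : L ≤ N) (h : Fin 2 → Fin NT × Fin L → ℂ)
    (w : Fin NT × Fin 2 × Fin N → ℂ) : S.C hL h w =
      ((1 / ((NT : ℝ) * S.s) : ℝ) : ℂ) • (S.Y hL h w * (S.Y hL h w)ᴴ) := by
  rw [C]
  push_cast
  rfl

theorem estimate_eq (hL0 : 0 < L) (hL : L ≤ N) (hP : S.P.Nonempty) (hΔ : 0 < S.Δ)
    (hNT : 0 < NT) (u : Fin 2) (h : Fin 2 → Fin NT × Fin L → ℂ)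
    (w : Fin NT × Fin 2 × Fin N → ℂ) : S.estimate hL u h w =
      (star (S.pilot u) ᵥ* (((1 / ((NT : ℝ) * S.s) : ℝ) : ℂ) •
        (S.Y hL h w * (S.Y hL h w)ᴴ))⁻¹) ᵥ* S.Y hL h w := by
  rw [estimate, W, S.T_eq_one hL0 hL hP hΔ hNT, one_smul, C_eq_ofReal_smul]

theorem fullGram_inr_inr (hL : L ≤ N) (u : Fin 2) (h : Fin 2 → Fin NT × Fin L → ℂ)
    (w : Fin NT × Fin 2 × Fin N → ℂ) : S.fullGram hL u h w (Sum.inr (), Sum.inr ()) =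
      ((1 / ((NT : ℝ) * S.s) : ℝ) : ℂ) * ∑ x, S.H hL h u x * star (S.H hL h u x) := by
  simp only [fullGram, rowComb_inr]
  push_cast
  rfl

theorem sqError_div_eq (hL0 : 0 < L) (hL : L ≤ N) (hP : S.P.Nonempty) (hΔ : 0 < S.Δ)
    (hNT : 0 < NT) (u : Fin 2) (h : Fin 2 → Fin NT × Fin L → ℂ)
    (w : Fin NT × Fin 2 × Fin N → ℂ) :
    1 / ((NT : ℝ) * S.s) * S.sqError hL u h w =
      gramError (S.pilot u) (S.fullGram hL u h w) := by
  rw [sqError, estimate_eq S hL0 hL hP hΔ hNT, mul_sum_norm_sub_sq_eq, gramError,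
    obsGram_fullGram, C_eq_ofReal_smul, fullGram_inr_inr]
  congr 1
  funext k
  simp only [fullGram, rowComb_inl, rowComb_inr]
  push_cast
  rfl

theorem sqError_div_le (hL0 : 0 < L) (hL : L ≤ N) (hP : S.P.Nonempty) (hΔ : 0 < S.Δ)
    (hNT : 0 < NT) (u : Fin 2) (h : Fin 2 → Fin NT × Fin L → ℂ)
    (w : Fin NT × Fin 2 × Fin N → ℂ) :
    1 / ((NT : ℝ) * S.s) * S.sqError hL u h w ≤
      2 * (‖(star (S.pilot u) ᵥ* (S.C hL h w).adjugate) ⬝ᵥ S.pilot u‖ *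
        ‖(S.C hL h w).det‖⁻¹) + 2 * ‖S.fullGram hL u h w (Sum.inr (), Sum.inr ())‖ := by
  rw [sqError, estimate_eq S hL0 hL hP hΔ hNT, C_eq_ofReal_smul, fullGram_inr_inr]
  exact mul_sum_norm_estimate_sub_sq_le _ _ (by positivity) _

variable {σ2 : ℝ} {h : (NT : ℕ) → Fin 2 → Fin NT × Fin L → Ω → ℂ}
  {w : (NT : ℕ) → Fin NT × Fin 2 × Fin N → Ω → ℂ}

theorem tendstoLTwo_fullGram [IsProbabilityMeasure μ] (hL0 : 0 < L) (hL : L ≤ N)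
    (hP : S.P.Nonempty) (hD : 0 < S.D) (hΔ : 0 < S.Δ)
    (hm : ∀ NT, S.IsModel μ NT σ2 (h NT) (w NT)) (u : Fin 2)
    (r : (Fin 2 ⊕ Unit) × (Fin 2 ⊕ Unit)) :
    TendstoLTwo μ (fun NT ω => S.fullGram hL u (fun v y => h NT v y ω) (fun y => w NT y ω) r)
      (S.limitGram σ2 u r) :=
  S.tendstoLTwo_inner_rowComb hL0 hL hP hD hΔ hm _ _ _ _

/-- The adjugate of a `2 × 2` matrix is linear in the entries, so mean-square convergence is
preserved. -/
theorem tendstoLTwo_adjugate [IsProbabilityMeasure μ] (hL0 : 0 < L) (hL : L ≤ N)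
    (hP : S.P.Nonempty) (hD : 0 < S.D) (hΔ : 0 < S.Δ)
    (hm : ∀ NT, S.IsModel μ NT σ2 (h NT) (w NT)) (u : Fin 2) :
    TendstoLTwo μ (fun NT ω => (star (S.pilot u) ᵥ*
      (S.C hL (fun v y => h NT v y ω) (fun y => w NT y ω)).adjugate) ⬝ᵥ S.pilot u)
      ((star (S.pilot u) ᵥ* (S.limitCov σ2).adjugate) ⬝ᵥ S.pilot u) := by
  have hG (k l : Fin 2) := S.tendstoLTwo_fullGram hL0 hL hP hD hΔ hm u (Sum.inl k, Sum.inl l)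
  set x := S.pilot u
  have := ((((hG 1 1).const_mul (star (x 0) * x 0)).add
    ((hG 0 1).const_mul (-(star (x 0) * x 1)))).add
    ((hG 1 0).const_mul (-(star (x 1) * x 0)))).add ((hG 0 0).const_mul (star (x 1) * x 1))
  have key (g : (Fin 2 ⊕ Unit) × (Fin 2 ⊕ Unit) → ℂ) :
      (star x ᵥ* (obsGram g).adjugate) ⬝ᵥ x = star (x 0) * x 0 * g (Sum.inl 1, Sum.inl 1) +
        -(star (x 0) * x 1) * g (Sum.inl 0, Sum.inl 1) +
        -(star (x 1) * x 0) * g (Sum.inl 1, Sum.inl 0) +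
        star (x 1) * x 1 * g (Sum.inl 0, Sum.inl 0) := by
    simp only [Matrix.adjugate_fin_two, Matrix.vecMul, dotProduct, Fin.sum_univ_two,
      Matrix.of_apply, Matrix.cons_val', Matrix.cons_val_zero, Matrix.cons_val_one,
      Matrix.cons_val_fin_one, obsGram, Pi.star_apply]
    ring
  simp only [← obsGram_fullGram S hL u, ← S.obsGram_limitGram σ2 u, key]
  exact this

theorem IsModel.aemeasurable_Y [IsProbabilityMeasure μ] {h : Fin 2 → Fin NT × Fin L → Ω → ℂ}
    {w : Fin NT × Fin 2 × Fin N → Ω → ℂ} (hm : S.IsModel μ NT σ2 h w) (hL : L ≤ N) (k : Fin 2)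
    (x : Fin NT × S.P) :
    AEMeasurable (fun ω => S.Y hL (fun v y => h v y ω) (fun y => w y ω) k x) μ := by
  simp only [← S.rowComb_inl hL 0 k]
  exact (hm.isCircularGaussian_rowComb S hL _ _).aemeasurable x

/-- The noise alone contributes `σ² (|p|² + |q|²)` times the identity to the covariance; the channel
part enters only as a nonnegative addition and may be degenerate. -/
theorem IsModel.lintegral_exp_neg_comb_Y_le [IsProbabilityMeasure μ]
    {h : Fin 2 → Fin NT × Fin L → Ω → ℂ} {w : Fin NT × Fin 2 × Fin N → Ω → ℂ}
    (hm : S.IsModel μ NT σ2 h w) (hL : L ≤ N) (hσ : 0 ≤ σ2) {l : ℝ} (hl : 0 < l) (p q : ℂ) :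
    ∫⁻ ω, ENNReal.ofReal (Real.exp (-(l * ∑ x,
      ‖p * S.Y hL (fun v y => h v y ω) (fun y => w y ω) 0 x +
        q * S.Y hL (fun v y => h v y ω) (fun y => w y ω) 1 x‖ ^ 2))) ∂μ ≤
      ENNReal.ofReal ((1 + l * σ2 * (‖p‖ ^ 2 + ‖q‖ ^ 2)) ^ (NT * S.s))⁻¹ := by
  set a : Fin 2 → ℂ := fun u => p * S.X 0 u + q * S.X 1 u
  set c : Fin 2 → ℂ := ![p, q]
  have hrow (ω : Ω) (x : Fin NT × S.P) :
      p * S.Y hL (fun v y => h v y ω) (fun y => w y ω) 0 x +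
        q * S.Y hL (fun v y => h v y ω) (fun y => w y ω) 1 x =
      S.rowComb hL a c (fun v y => h v y ω) (fun y => w y ω) x := by
    simp [rowComb, Y, Matrix.mul_apply, Fin.sum_univ_two, a, c]
    ring
  simp only [hrow]
  have hG := hm.isCircularGaussian_rowComb S hL a c
  have hs : (σ2 : ℂ) * ∑ k, c k * star (c k) = ((σ2 * (‖p‖ ^ 2 + ‖q‖ ^ 2) : ℝ) : ℂ) := by
    simp only [mul_star_self_eq, Fin.sum_univ_two, c, Matrix.cons_val_zero, Matrix.cons_val_one,
      Matrix.cons_val_fin_one]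
    push_cast
    rfl
  have hG' := hG
  rw [hs] at hG'
  have hb := (hm.isCircularGaussian_channel S hL a).integral_exp_neg_le (by positivity) hl hG'
  have hm' (x : Fin NT × S.P) : AEMeasurable
      (fun ω => S.rowComb hL a c (fun v y => h v y ω) (fun y => w y ω) x) μ := hG.aemeasurable x
  have hint : Integrable (fun ω => Real.exp (-(l * ∑ x,
      ‖S.rowComb hL a c (fun v y => h v y ω) (fun y => w y ω) x‖ ^ 2))) μ := by
    refine (integrable_const (1 : ℝ)).mono' (AEMeasurable.aestronglyMeasurable (by fun_prop))
      (ae_of_all _ fun ω => ?_)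
    rw [Real.norm_of_nonneg (Real.exp_pos _).le, Real.exp_le_one_iff, neg_nonpos]
    positivity
  rw [← ofReal_integral_eq_lintegral_ofReal hint (ae_of_all _ fun _ => (Real.exp_pos _).le)]
  apply ENNReal.ofReal_le_ofReal
  refine hb.trans (le_of_eq ?_)
  rw [Fintype.card_prod, Fintype.card_fin, Fintype.card_coe, mul_assoc]
  rfl

theorem eventually_eLpNorm_inv_det_le [IsProbabilityMeasure μ] (hL : L ≤ N) (hP : S.P.Nonempty)
    (hσ : 0 < σ2) (hm : ∀ NT, S.IsModel μ NT σ2 (h NT) (w NT)) :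
    ∃ K : ℝ≥0∞, K ≠ ∞ ∧ ∀ᶠ NT in atTop, eLpNorm (fun ω =>
      ‖(S.C hL (fun v y => h NT v y ω) (fun y => w NT y ω)).det‖⁻¹) 2 μ ≤ K := by
  obtain ⟨K, hK, hb⟩ := exists_lintegral_inv_det_sq_le hσ μ
  refine ⟨K ^ (1 / 2 : ℝ), by finiteness, ?_⟩
  filter_upwards [eventually_ge_atTop 10] with NT hNT
  have hs : 0 < S.s := hP.card_pos
  have hn : 10 ≤ NT * S.s := by nlinarith
  have hpos : 0 < NT * S.s := by omega
  have hpos' : (0 : ℝ) < ((NT * S.s : ℕ) : ℝ) := by exact_mod_cast hpos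
  have := hb (NT * S.s) (Fin NT × S.P)
    (fun ω => S.Y hL (fun v y => h NT v y ω) (fun y => w NT y ω)) hn
    (fun k x => (hm NT).aemeasurable_Y S hL k x)
    (fun p q => (hm NT).lintegral_exp_neg_comb_Y_le S hL hσ.le (by positivity) p q)
  rw [eLpNorm_eq_lintegral_rpow_enorm_toReal two_ne_zero (by simp)]
  simp only [ENNReal.toReal_ofNat]
  refine ENNReal.rpow_le_rpow (le_trans (le_of_eq ?_) this) (by norm_num)
  refine lintegral_congr fun ω => ?_
  rw [Real.enorm_eq_ofReal (by positivity), C_eq_ofReal_smul, ENNReal.rpow_two]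
  push_cast
  rfl

theorem integrable_and_tendsto_nmse [IsProbabilityMeasure μ] (hL0 : 0 < L) (hL : L ≤ N)
    (hP : S.P.Nonempty) (hD : 0 < S.D) (hΔ : 0 < S.Δ) (hρ : ∀ u, 0 < S.ρ u) (hσ : 0 < σ2)
    (hm : ∀ NT, S.IsModel μ NT σ2 (h NT) (w NT)) (u : Fin 2) :
    (∀ᶠ NT in atTop, Integrable (fun ω =>
      S.sqError hL u (fun v y => h NT v y ω) (fun y => w NT y ω)) μ) ∧
    Tendsto (fun NT => S.nmse hL μ u (h NT) (w NT)) atTop (𝓝 (S.limitError u σ2)) := by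
  have hs : (0 : ℝ) < S.s := by exact_mod_cast hP.card_pos
  set g : ℕ → Ω → (Fin 2 ⊕ Unit) × (Fin 2 ⊕ Unit) → ℂ := fun NT ω =>
    S.fullGram hL u (fun v y => h NT v y ω) (fun y => w NT y ω) with hg
  have hgL (r) : TendstoLTwo μ (fun NT ω => g NT ω r) (S.limitGram σ2 u r) :=
    S.tendstoLTwo_fullGram hL0 hL hP hD hΔ hm u r
  have hgm (NT) : AEMeasurable (g NT) μ :=
    aemeasurable_pi_lambda _ fun r => ((hgL r).1 NT).aemeasurable
  have hconv : TendstoInMeasure μ (fun NT ω => gramError (S.pilot u) (g NT ω)) atTop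
      (fun _ => S.limitError u σ2) := by
    have := tendstoInMeasure_comp_of_continuousAt (fun r => (hgL r).tendstoInMeasure)
      (continuousAt_gramError (S.pilot u) (by
        rw [obsGram_limitGram]
        exact S.limitCov_det_ne_zero hρ hσ))
    rwa [gramError_limitGram S hρ hσ] at this
  obtain ⟨K, hK, hBK⟩ := S.eventually_eLpNorm_inv_det_le hL hP hσ hm
  have hdiv : ∀ᶠ NT in atTop, ∀ ω, gramError (S.pilot u) (g NT ω) =
      1 / ((NT : ℝ) * S.s) * S.sqError hL u (fun v y => h NT v y ω) (fun y => w NT y ω) := by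
    filter_upwards [eventually_gt_atTop 0] with NT hNT ω
    exact (S.sqError_div_eq hL0 hL hP hΔ hNT u _ _).symm
  have hnonneg : ∀ᶠ NT in atTop, ∀ ω, 0 ≤ gramError (S.pilot u) (g NT ω) := by
    filter_upwards [hdiv] with NT hNT ω
    rw [hNT, sqError]
    positivity
  have hlim0 : 0 ≤ S.limitError u σ2 := by
    have h0 := hρ 0
    have h1 := hρ 1
    rw [limitError, sub_nonneg]
    refine div_le_one_of_le₀ ?_ (by positivity)
    have : S.ρ u ≤ S.ρ 0 + S.ρ 1 := by
      fin_cases u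
      · exact le_add_of_nonneg_right h1.le
      · exact le_add_of_nonneg_left h0.le
    nlinarith
  -- `A` is the adjugate form, `B` the inverse determinant and `Q` the channel power; only `B` lacks
  -- a mean-square limit, and a uniform bound replaces it.
  obtain ⟨hint, hlim⟩ := tendsto_integral_of_le_mul_add
    (X := fun NT ω => gramError (S.pilot u) (g NT ω))
    (A := fun NT ω => ‖(star (S.pilot u) ᵥ*
      (S.C hL (fun v y => h NT v y ω) (fun y => w NT y ω)).adjugate) ⬝ᵥ S.pilot u‖)
    (B := fun NT ω => ‖(S.C hL (fun v y => h NT v y ω) (fun y => w NT y ω)).det‖⁻¹)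
    (Q := fun NT ω => ‖g NT ω (Sum.inr (), Sum.inr ())‖)
    (fun NT => ((measurable_gramError (S.pilot u)).comp_aemeasurable (hgm NT)).aestronglyMeasurable)
    (fun NT => by
      have hgm' (r) : AEMeasurable (fun ω => g NT ω r) μ := ((hgL r).1 NT).aemeasurable
      simp only [← obsGram_fullGram S hL u, Matrix.det_fin_two, obsGram, Matrix.of_apply]
      exact AEMeasurable.aestronglyMeasurable
        ((((hgm' _).mul (hgm' _)).sub ((hgm' _).mul (hgm' _))).norm.inv))
    hnonneg hlim0 (fun _ _ => by positivity) hK hBK (norm_nonneg _) (norm_nonneg _)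
    (S.tendstoLTwo_adjugate hL0 hL hP hD hΔ hm u).norm (hgL _).norm
    (by
      filter_upwards [eventually_gt_atTop 0, hdiv] with NT hNT hd ω
      rw [hd]
      exact S.sqError_div_le hL0 hL hP hΔ hNT u _ _)
    hconv
  constructor
  · filter_upwards [hint, hdiv, eventually_gt_atTop 0] with NT hi hd hNT
    have hn : (0 : ℝ) < NT := by exact_mod_cast hNT
    refine (hi.const_mul ((NT : ℝ) * S.s)).congr (ae_of_all _ fun ω => ?_)
    simp only [hd]
    field_simp
  · refine hlim.congr' ?_
    filter_upwards [hdiv] with NT hd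
    simp only [hd]
    rw [integral_const_mul, nmse]
    ring

end Setup

end PilotTraining

/-! ### Conclusion: large arrays, then vanishing noise. -/

theorem proposition3 {N L : ℕ} (S : PilotTraining.Setup N L) (hL0 : 0 < L) (hL : L ≤ N)
    (hP : S.P.Nonempty) (hD : 0 < S.D) (hΔ : 0 < S.Δ) (hρ : ∀ u, 0 < S.ρ u)
    (hX : IsUnit S.X.det ∨ S.ρ 0 = S.ρ 1)
    {Ω : Type*} [MeasurableSpace Ω] (μ : Measure Ω) [IsProbabilityMeasure μ]
    (h : (σ2 : ℝ) → (NT : ℕ) → Fin 2 → Fin NT × Fin L → Ω → ℂ)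
    (w : (σ2 : ℝ) → (NT : ℕ) → Fin NT × Fin 2 × Fin N → Ω → ℂ)
    (hmodel : ∀ σ2 : ℝ, 0 < σ2 → ∀ NT : ℕ, S.IsModel μ NT σ2 (h σ2 NT) (w σ2 NT)) :
    (∀ σ2 : ℝ, 0 < σ2 → ∀ u : Fin 2, ∀ᶠ NT : ℕ in atTop,
      Integrable (fun ω => S.sqError hL u (fun v x => h σ2 NT v x ω) (fun x => w σ2 NT x ω)) μ) ∧
    ∃ εB εA : ℝ → ℝ,
      (∀ σ2 : ℝ, 0 < σ2 →
        Tendsto (fun NT : ℕ => S.nmse hL μ 0 (h σ2 NT) (w σ2 NT)) atTop (𝓝 (εB σ2)) ∧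
        Tendsto (fun NT : ℕ => S.nmse hL μ 1 (h σ2 NT) (w σ2 NT)) atTop (𝓝 (εA σ2))) ∧
      ∃ e : ℝ, Tendsto εB (𝓝[>] 0) (𝓝 e) ∧ Tendsto εA (𝓝[>] 0) (𝓝 e) := by
  have key (σ2 : ℝ) (hσ : 0 < σ2) (u : Fin 2) :=
    S.integrable_and_tendsto_nmse hL0 hL hP hD hΔ hρ hσ (hmodel σ2 hσ) u
  obtain ⟨e, he⟩ := S.exists_tendsto_limitError hρ hX
  exact ⟨fun σ2 hσ u => (key σ2 hσ u).1, S.limitError 0, S.limitError 1,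
    fun σ2 hσ => ⟨(key σ2 hσ 0).2, (key σ2 hσ 1).2⟩, e, he 0, he 1⟩
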